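/- Let $m\ge 1$ and let $\mathcal T_m$ be the triangle of vertices $(x,y)\in\mathbb Z^2$ with $1-m\le x\le 0$, $0\le y\le m-1$, $x+y\ge 0$ of the triangular lattice, in which each vertex $p$ is joined to $p\pm(1,0)$, $p\pm(1,-1)$, $p\pm(0,-1)$; so $p$ has six edges W, NW, N, E, SE, S, and edges with only one endpoint in $\mathcal T_m$ are called external. A configuration of the twenty-vertex (20V) model on $\mathcal T_m$ is an orientation of all edges with at least one endpoint in $\mathcal T_m$ such that each vertex of $\mathcal T_m$ has exactly three incoming and three outgoing edges. An edge oriented in the direction $(1,0)$, $(1,-1)$ or $(0,-1)$ is called a path step (so every other edge is oriented oppositely to these directions), and a vertex is visited if at least one of its six edges is a path step. The models $20V_1,20V_2,20V_3$ are defined by prescribing exactly which external edges are path steps: * $20V_3$: the W edges of the vertices $(-y,y)$ with $2y\ge m-1$ and the S edges of the vertices $(-y,y)$ with $2y\le m-1$; no external edge on the top row (N, NW) or in the rightmost column (E, SE) is a path step. * $20V_2$: the NW edges of the top-row vertices $(x,m-1)$ with $2x+m-1\le 0$, the N edges of the top-row vertices with $2x+m-1<0$, and the S edges of all vertices $(-y,y)$;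 no other external edge is a path step. * $20V_1$: the SE edges of the rightmost vertices $(0,y)$ with $2y\le m-1$, the E edges of the rightmost vertices with $2y<m-1$, and the W edges of all vertices $(-y,y)$; no other external edge is a path step. For $1\le k\le m$ let $Z^{20V_i}_{m,k}$ be the number of configurations of $20V_i$ on $\mathcal T_m$ such that: for $i=2,3$, the topmost visited vertex of the rightmost column is $(0,k-1)$ (the $k$-th from the bottom); for $i=1$, the rightmost visited vertex of the top row, i.e. the vertex where the topmost path leaves the top row, is $(k-m,m-1)$ (the $k$-th from the left). Put $$Z_m^{20V_i}(\tau)=\sum_{k=1}^m Z^{20V_i}_{m,k}\,\tau^{k-1}\in\mathbb Z[\tau].$$ Then for all $n\ge 1$ and $i=1,2,3$, $$Z_{2n}^{20V_i}(\tau)=2^{n-1}(1+\tau)\,Z_{2n-1}^{20V_i}(\tau).$$ -/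

import Mathlib

/-- The three directions of lines of the triangular lattice, drawn with vertex set `ℤ × ℤ`. -/
inductive TwentyV.Dir
  | horizontal
  | diagonal
  | vertical
  deriving DecidableEq

/-- The three models, distinguished by their domain wall boundary conditions. -/
inductive TwentyV.Model
  | V1
  | V2
  | V3
  deriving DecidableEq

namespace TwentyV

instance : Fintype Dir where
  elems := {.horizontal, .diagonal, .vertical}
  complete := fun d => by cases d <;> simp

/-- Schröder path steps: horizontal `(1,0)`, diagonal `(1,-1)`, vertical `(0,-1)`. -/
def step : Dir → ℤ × ℤ
  | .horizontal => (1, 0)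
  | .diagonal => (1, -1)
  | .vertical => (0, -1)

/-- An edge of the triangular lattice: `(d, p)` joins `p` to `p + step d`. -/
abbrev Edge := Dir × (ℤ × ℤ)

/-- The edge of direction `d` that a step in this direction uses to arrive at `p`
(the West, North-West, North edge of `p` for `d` horizontal, diagonal, vertical). -/
def edgeTo (d : Dir) (p : ℤ × ℤ) : Edge := (d, p - step d)

/-- The edge of direction `d` that a step in this direction uses to leave `p`
(the East, South-East, South edge of `p` for `d` horizontal, diagonal, vertical). -/
def edgeFrom (d : Dir) (p : ℤ × ℤ) : Edge := (d, p)

/-- The vertices of the triangle of size `m`, whose extremal vertices are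
`(0,0)`, `(1-m,m-1)` and `(0,m-1)`. -/
noncomputable def vertices (m : ℕ) : Finset (ℤ × ℤ) :=
  (Finset.Icc (1 - (m : ℤ)) 0 ×ˢ Finset.Icc 0 ((m : ℤ) - 1)).filter fun p => 0 ≤ p.1 + p.2

/-- All edges incident to some vertex of the triangle, external (boundary) edges included. -/
noncomputable def edges (m : ℕ) : Finset Edge :=
  (vertices m).biUnion fun p =>
    Finset.univ.image (fun d => edgeTo d p) ∪ Finset.univ.image (fun d => edgeFrom d p)

/-- An orientation of the edges is encoded by the set `P` of the edges `(d, p)` that are oriented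
from `p` to `p + step d`; these are the edges that carry a path step. All other edges are oriented
the opposite way. This is the number of edges at `p` which point to `p`. -/
def numIncoming (P : Finset Edge) (p : ℤ × ℤ) : ℕ :=
  (Finset.univ.filter fun d => edgeTo d p ∈ P).card +
    (Finset.univ.filter fun d => edgeFrom d p ∉ P).card

/-- The number of edges at `p` which point away from `p`. -/
def numOutgoing (P : Finset Edge) (p : ℤ × ℤ) : ℕ :=
  (Finset.univ.filter fun d => edgeFrom d p ∈ P).card +
    (Finset.univ.filter fun d => edgeTo d p ∉ P).card

/-- The ice rule at `p`: three incoming and three outgoing edges. -/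
def IceRule (P : Finset Edge) (p : ℤ × ℤ) : Prop :=
  numIncoming P p = 3 ∧ numOutgoing P p = 3

/-- For each model, which edges attached to the North side of the triangle carry a path step,
as a function of the direction of the edge and of its end `p` in the top row.
For the second model, both external edges are path steps at the left half of the vertices, none at
the right half, and the diagonal one only at the middle vertex (`m` odd). -/
def northPath (i : Model) (m : ℕ) (d : Dir) (p : ℤ × ℤ) : Prop :=
  match i, d with
  | .V1, _ => False
  | .V2, .diagonal => 2 * p.1 + ((m : ℤ) - 1) ≤ 0
  | .V2, .vertical => 2 * p.1 + ((m : ℤ) - 1) < 0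
  | .V2, .horizontal => False
  | .V3, _ => False

/-- The same for the East side, `p` being the end of the edge in the rightmost column.
For the first model, both external edges are path steps at the bottom half of the vertices, none at
the top half, and the diagonal one only at the middle vertex (`m` odd). -/
def eastPath (i : Model) (m : ℕ) (d : Dir) (p : ℤ × ℤ) : Prop :=
  match i, d with
  | .V1, .diagonal => 2 * p.2 ≤ (m : ℤ) - 1
  | .V1, .horizontal => 2 * p.2 < (m : ℤ) - 1
  | .V1, .vertical => False
  | .V2, _ => False
  | .V3, _ => False

/-- The same for the diagonal side `x + y = 0`, `p` being the end of the edge on this side.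
For the third model, all external edges (West and South) point inward at the top half of the
vertices and outward at the bottom half, and at the middle vertex (`m` odd) the West edge points
inward and the South edge outward. -/
def diagPath (i : Model) (m : ℕ) (d : Dir) (p : ℤ × ℤ) : Prop :=
  match i, d with
  | .V1, .horizontal => True
  | .V1, _ => False
  | .V2, .vertical => True
  | .V2, _ => False
  | .V3, .horizontal => (m : ℤ) - 1 ≤ 2 * p.2
  | .V3, .vertical => 2 * p.2 ≤ (m : ℤ) - 1
  | .V3, .diagonal => False

/-- The boundary conditions: all external edges of the triangle are prescribed. -/
def BoundaryCondition (i : Model) (m : ℕ) (P : Finset Edge) : Prop :=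
  ∀ p ∈ vertices m,
    (p.2 = (m : ℤ) - 1 →
      (edgeTo .diagonal p ∈ P ↔ northPath i m .diagonal p) ∧
      (edgeTo .vertical p ∈ P ↔ northPath i m .vertical p)) ∧
    (p.1 = 0 →
      (edgeFrom .horizontal p ∈ P ↔ eastPath i m .horizontal p) ∧
      (edgeFrom .diagonal p ∈ P ↔ eastPath i m .diagonal p)) ∧
    (p.1 + p.2 = 0 →
      (edgeTo .horizontal p ∈ P ↔ diagPath i m .horizontal p) ∧
      (edgeFrom .vertical p ∈ P ↔ diagPath i m .vertical p))

/-- A configuration of the model `i` on the triangle of size `m`. -/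
def IsConfig (i : Model) (m : ℕ) (P : Finset Edge) : Prop :=
  P ⊆ edges m ∧ (∀ p ∈ vertices m, IceRule P p) ∧ BoundaryCondition i m P

/-- Some path visits the vertex `p`. -/
def Visited (P : Finset Edge) (p : ℤ × ℤ) : Prop :=
  ∃ d : Dir, edgeTo d p ∈ P ∨ edgeFrom d p ∈ P

/-- The statistic used for the refined enumeration. For the second and third models: the topmost
visited vertex of the rightmost vertical line is the `k`-th from the bottom. For the first model:
the topmost path leaves the topmost horizontal line at its `k`-th vertex from the left, that is,
the last visited vertex of this line is the `k`-th one. -/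
def HasPosition (i : Model) (m : ℕ) (k : ℕ) (P : Finset Edge) : Prop :=
  match i with
  | .V1 => Visited P ((k : ℤ) - m, (m : ℤ) - 1) ∧
      ∀ x : ℤ, (k : ℤ) - m < x → x ≤ 0 → ¬ Visited P (x, (m : ℤ) - 1)
  | _ => Visited P (0, (k : ℤ) - 1) ∧
      ∀ y : ℤ, (k : ℤ) - 1 < y → y ≤ (m : ℤ) - 1 → ¬ Visited P (0, y)

open Classical in
/-- The refined number of configurations. -/
noncomputable def refinedCount (i : Model) (m k : ℕ) : ℕ :=
  ((edges m).powerset.filter fun P => IsConfig i m P ∧ HasPosition i m k P).card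

/-- The refined generating polynomial `∑_{k=1}^m Z_{m,k} τ^(k-1)`, with `τ = X`. -/
noncomputable def refinedZ (i : Model) (m : ℕ) : Polynomial ℤ :=
  ∑ k ∈ Finset.Icc 1 m, Polynomial.C (refinedCount i m k : ℤ) * Polynomial.X ^ (k - 1)

end TwentyV

namespace TwentyV

/-! The third model is solved with a star-triangle relation, and the other two are deduced from it
by symmetry. Resolve each triple crossing into three six-vertex crossings of weights 1 and √2. Up to
a factor 2 this reproduces the uniform 20V weight (`tripleWeight_eq`), wherever the diagonal line
passes relative to the crossing of the other two. In the rightmost column, whose East and South-East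
exits are empty, deformed crossings reproduce, up to a factor `1 + t`, the weight `t` per vertical
step entering a vertex (`tripleColumnWeight_eq`). Since the path in that column descends to its
bottom, these weights multiply to `t ^ (k - 1)`.

A diagonal line enters and leaves the triangle empty. It can therefore be pushed North-East through
all the other diagonals and out of the triangle, at the cost of a scalar which is exactly the
normalisation of the resolved weights. What remains is a six-vertex model on horizontal and vertical
lines alone (`diagPartition_eq_sixPartition`).

With the 20V3 boundary in even size, the outer diagonal of this six-vertex model is frozen: every
line goes straight, with total weight `2 ^ k * (1 + t)` in size `2 * k + 2`. The states it hands to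
the next diagonal are the 20V3 boundary of size `2 * k + 1`. This gives the factorisation
(`diagPartition_even`).

A reflection of the triangle identifies 20V1 with 20V2. Another one, which complements the vertical
edges, identifies 20V2 with 20V3 and reverses the position to `m + 1 - k`. The factor `1 + τ` is
palindromic, so the relation survives `τ ↦ 1/τ`. Evaluation at real `t > 0` determines the
polynomials. -/

/-! ### Six-vertex crossings and star-triangle relations. -/

/-- The weight of the crossing of two lines whose states change from `x` to `x'` and from `y` to
`y'`, in the symmetric six-vertex model with weights `a`, `b`, `c`. -/
def sixWeight (a b c : ℝ) (x y x' y' : Bool) : ℝ :=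
  if x = x' ∧ y = y' then (if x = y then a else b) else if x = y' ∧ y = x' then c else 0

/-- The uniform weight of the twenty-vertex model. -/
def twentyWeight (h d n e d' v : Bool) : ℝ :=
  if h.toNat + d.toNat + n.toNat = e.toNat + d'.toNat + v.toNat then 1 else 0

/-- The weight of a vertex in the rightmost column, in which the steps arriving along
the column are counted with the weight `t`. -/
def columnWeight (t : ℝ) (h d n v : Bool) : ℝ :=
  if h.toNat + d.toNat + n.toNat = v.toNat then (if n then t else 1) else 0

/-- The crossing of the diagonal line with a vertical line; `last` tells whether the latter is the
rightmost column. -/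
noncomputable def diagVertWeight (r t : ℝ) (last : Bool) : Bool → Bool → Bool → Bool → ℝ :=
  if last then sixWeight (r * (1 + t) / 2) t 1 else sixWeight r 1 1

/-- The crossing of a horizontal line with a vertical line. -/
noncomputable def horVertWeight (r t : ℝ) (last : Bool) : Bool → Bool → Bool → Bool → ℝ :=
  if last then sixWeight 1 (r * (1 + t) / 2) 1 else sixWeight 1 r 1

/-- A triple crossing with the diagonal line passing to the North-East. -/
noncomputable def tripleWeight (r t : ℝ) (h d n e d' v : Bool) : ℝ :=
  ∑ d1, ∑ n1, ∑ e1, diagVertWeight r t false d n d1 n1 * horVertWeight r t false h n1 e1 v *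
    sixWeight r 1 1 d1 e1 d' e

/-- A triple crossing in the rightmost column with the diagonal line passing to the North-East. -/
noncomputable def tripleColumnWeight (r t : ℝ) (h d n v : Bool) : ℝ :=
  ∑ d1, ∑ n1, ∑ e1, diagVertWeight r t true d n d1 n1 * horVertWeight r t true h n1 e1 v *
    sixWeight r 1 1 d1 e1 false false

/-- Checked on the 64 boundary states. The sum is empty of nonzero terms unless the number of path
steps is conserved, and then it is either one term `r * r` or two terms equal to 1. -/
theorem tripleWeight_eq {r t : ℝ} (hr : r * r = 2) (h d n e d' v : Bool) :
    tripleWeight r t h d n e d' v = 2 * twentyWeight h d n e d' v := by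
  cases h <;> cases d <;> cases n <;> cases e <;> cases d' <;> cases v <;>
    simp [tripleWeight, twentyWeight, diagVertWeight, horVertWeight, sixWeight] <;>
    first | done | linear_combination hr | norm_num

/-- The star-triangle relation: the diagonal line may pass on either side of the crossing of the
other two lines. -/
theorem tripleWeight_eq_southWest {r t : ℝ} (hr : r * r = 2) (h d n e d' v : Bool) :
    ∑ d1, ∑ h1, ∑ v1, sixWeight r 1 1 d h d1 h1 * horVertWeight r t false h1 n e v1 *
      diagVertWeight r t false d1 v1 d' v = tripleWeight r t h d n e d' v := by
  rw [tripleWeight_eq hr]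
  cases h <;> cases d <;> cases n <;> cases e <;> cases d' <;> cases v <;>
    simp [twentyWeight, diagVertWeight, horVertWeight, sixWeight] <;>
    first | done | linear_combination hr | norm_num

theorem tripleColumnWeight_eq {r t : ℝ} (hr : r * r = 2) (h d n v : Bool) :
    tripleColumnWeight r t h d n v = (1 + t) * columnWeight t h d n v := by
  cases h <;> cases d <;> cases n <;> cases v <;>
    simp [tripleColumnWeight, columnWeight, diagVertWeight, horVertWeight, sixWeight] <;>
    first | done | linear_combination (1 + t) / 2 * hr | linear_combination (1 + t) / 2 * t * hr

/-- The star-triangle relation in the deformed column, for empty East and South-East exits, which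
are the only ones met there. -/
theorem tripleColumnWeight_eq_southWest {r t : ℝ} (hr : r * r = 2) (h d n v : Bool) :
    ∑ d1, ∑ h1, ∑ v1, sixWeight r 1 1 d h d1 h1 * horVertWeight r t true h1 n false v1 *
      diagVertWeight r t true d1 v1 false v = tripleColumnWeight r t h d n v := by
  rw [tripleColumnWeight_eq hr]
  cases h <;> cases d <;> cases n <;> cases v <;>
    simp [columnWeight, diagVertWeight, horVertWeight, sixWeight] <;>
    first | done | linear_combination (1 + t) / 2 * hr | ring1 |
      (left; linear_combination (1 + t) / 2 * hr)

/-! ### Transfer operators along a diagonal. -/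

/-- The states of the horizontal and vertical edges met along a diagonal. -/
abbrev States := List (Bool × Bool)

/-- The transfer operator of a diagonal whose vertices have weights `w`, and `w0` for the last one.
Here `d` and `n` are the states of the first diagonal edge and of the first vertical one. -/
def diagRow (w : Bool → Bool → Bool → Bool → Bool → Bool → ℝ) (w0 : Bool → Bool → Bool → Bool → ℝ) :
    Bool → Bool → States → (States → ℝ) → ℝ
  | _, _, [], _ => 0
  | d, n, [p], F => w0 p.1 d n p.2 * F []
  | d, n, p :: q :: l, F => ∑ e, ∑ d', ∑ n', w p.1 d n e d' p.2 *
      diagRow w w0 d' n' (q :: l) fun u => F ((e, n') :: u)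

/-- The transfer operator of a diagonal without diagonal line. -/
noncomputable def sixRow (r t : ℝ) : Bool → States → (States → ℝ) → ℝ
  | _, [], _ => 0
  | n, [p], F => horVertWeight r t true p.1 n false p.2 * F []
  | n, p :: q :: l, F => ∑ e, ∑ n', horVertWeight r t false p.1 n e p.2 *
      sixRow r t n' (q :: l) fun u => F ((e, n') :: u)

/-- The operator of a single diagonal line which crosses a sequence of lines. -/
noncomputable def crossLine (r t : ℝ) : Bool → States → (States → ℝ) → ℝ
  | d, [], F => if d then 0 else F []
  | d, p :: l, F => ∑ d1, ∑ h1, ∑ d2, ∑ v1, sixWeight r 1 1 d p.1 d1 h1 *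
      diagVertWeight r t l.isEmpty d1 v1 d2 p.2 * crossLine r t d2 l fun u => F ((h1, v1) :: u)

theorem diagRow_smul {w w' : Bool → Bool → Bool → Bool → Bool → Bool → ℝ}
    {w0 w0' : Bool → Bool → Bool → Bool → ℝ} {a b : ℝ}
    (hw : ∀ h d n e d' v, w h d n e d' v = a * w' h d n e d' v)
    (hw0 : ∀ h d n v, w0 h d n v = b * w0' h d n v) (p : Bool × Bool) (l : States) :
    ∀ (d n : Bool) (F : States → ℝ), diagRow w w0 d n (p :: l) F =
      a ^ l.length * b * diagRow w' w0' d n (p :: l) F := by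
  induction l generalizing p with
  | nil => intro d n F; simp [diagRow, hw0, mul_assoc]
  | cons q l ih =>
    intro d n F
    simp only [diagRow, ih, hw, Finset.mul_sum, List.length_cons]
    refine Finset.sum_congr rfl fun e _ => Finset.sum_congr rfl fun d' _ =>
      Finset.sum_congr rfl fun n' _ => by ring

theorem sixRow_sum {r t : ℝ} {ι : Type*} (s : Finset ι) (l : States) :
    ∀ (n : Bool) (c : ι → ℝ) (F : ι → States → ℝ),
      sixRow r t n l (fun u => ∑ i ∈ s, c i * F i u) = ∑ i ∈ s, c i * sixRow r t n l (F i) := by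
  induction l with
  | nil => intro n c F; simp [sixRow]
  | cons p l ih =>
    intro n c F
    cases l with
    | nil =>
      simp only [sixRow, Finset.mul_sum]
      exact Finset.sum_congr rfl fun i _ => by ring
    | cons q l =>
      simp only [sixRow, ih, Finset.mul_sum]
      simp only [Fintype.sum_bool, ← Finset.sum_add_distrib]
      exact Finset.sum_congr rfl fun i _ => by ring

theorem crossLine_sum {r t : ℝ} {ι : Type*} (s : Finset ι) (l : States) :
    ∀ (d : Bool) (c : ι → ℝ) (F : ι → States → ℝ),
      crossLine r t d l (fun u => ∑ i ∈ s, c i * F i u) =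
        ∑ i ∈ s, c i * crossLine r t d l (F i) := by
  induction l with
  | nil => intro d c F; cases d <;> simp [crossLine]
  | cons p l ih =>
    intro n c F
    simp only [crossLine, ih, Finset.mul_sum]
    simp only [Fintype.sum_bool, ← Finset.sum_add_distrib]
    exact Finset.sum_congr rfl fun i _ => by ring

theorem sixRow_congr {r t : ℝ} (p : Bool × Bool) (l : States) :
    ∀ (n : Bool) (F F' : States → ℝ), (∀ u, u.length = l.length → F u = F' u) →
      sixRow r t n (p :: l) F = sixRow r t n (p :: l) F' := by
  induction l generalizing p with
  | nil => intro n F F' h; simp [sixRow, h]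
  | cons q l ih =>
    intro n F F' h
    simp only [sixRow]
    refine Finset.sum_congr rfl fun e _ => Finset.sum_congr rfl fun n' _ => ?_
    rw [ih q n' _ (fun u => F' ((e, n') :: u))]
    intro u hu
    exact h _ (by simp [hu])

theorem crossLine_congr {r t : ℝ} (l : States) :
    ∀ (d : Bool) (F F' : States → ℝ), (∀ u, u.length = l.length → F u = F' u) →
      crossLine r t d l F = crossLine r t d l F' := by
  induction l with
  | nil => intro d F F' h; simp [crossLine, h]
  | cons q l ih =>
    intro d F F' h
    simp only [crossLine]
    refine Finset.sum_congr rfl fun d1 _ => Finset.sum_congr rfl fun h1 _ =>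
      Finset.sum_congr rfl fun d2 _ => Finset.sum_congr rfl fun v1 _ => ?_
    rw [ih d2 _ (fun u => F' ((h1, v1) :: u))]
    intro u hu
    exact h _ (by simp [hu])

theorem diagRow_congr {w : Bool → Bool → Bool → Bool → Bool → Bool → ℝ}
    {w0 : Bool → Bool → Bool → Bool → ℝ} (p : Bool × Bool) (l : States) :
    ∀ (d n : Bool) (F F' : States → ℝ), (∀ u, u.length = l.length → F u = F' u) →
      diagRow w w0 d n (p :: l) F = diagRow w w0 d n (p :: l) F' := by
  induction l generalizing p with
  | nil => intro d n F F' h; simp [diagRow, h]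
  | cons q l ih =>
    intro d n F F' h
    simp only [diagRow]
    refine Finset.sum_congr rfl fun e _ => Finset.sum_congr rfl fun d' _ =>
      Finset.sum_congr rfl fun n' _ => ?_
    rw [ih q d' n' _ (fun u => F' ((e, n') :: u))]
    intro u hu
    exact h _ (by simp [hu])

/-! ### Moving a diagonal line across a diagonal of vertices. -/

theorem crossLine_cons {r t : ℝ} (d : Bool) (p : Bool × Bool) (l : States) (F : States → ℝ) :
    crossLine r t d (p :: l) F = ∑ i : Bool × Bool × Bool × Bool,
      (sixWeight r 1 1 d p.1 i.1 i.2.1 * diagVertWeight r t l.isEmpty i.1 i.2.2.2 i.2.2.1 p.2) *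
        crossLine r t i.2.2.1 l fun u => F ((i.2.1, i.2.2.2) :: u) := by
  simp only [crossLine, Fintype.sum_prod_type]

/-- A regrouping of crossings, with no star-triangle relation. When the line passes to the
North-East, it meets the first vertical line and then only edges that have already left the
diagonal, so its remaining crossings act after `sixRow`. The factor `r` is its last crossing, with
the last horizontal line, where both exits are empty. -/
theorem diagRow_eq_sixRow_crossLine {r t : ℝ} (p : Bool × Bool) (l : States) :
    ∀ (d n : Bool) (F : States → ℝ),
      diagRow (tripleWeight r t) (tripleColumnWeight r t) d n (p :: l) F =
        r * ∑ d1, ∑ n1, diagVertWeight r t l.isEmpty d n d1 n1 *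
          sixRow r t n1 (p :: l) (fun u => crossLine r t d1 u F) := by
  induction l generalizing p with
  | nil =>
    intro d n F
    simp only [diagRow, sixRow, crossLine, tripleColumnWeight, Fintype.sum_bool, List.isEmpty_nil]
    simp [sixWeight]
    ring
  | cons q l ih =>
    intro d n F
    have key : ∀ e1 n' d1, sixRow r t n' (q :: l) (fun u => crossLine r t d1 ((e1, n') :: u) F) =
        ∑ i : Bool × Bool × Bool × Bool, (sixWeight r 1 1 d1 e1 i.1 i.2.1 *
          diagVertWeight r t l.isEmpty i.1 i.2.2.2 i.2.2.1 n') * sixRow r t n' (q :: l) (fun u =>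
            crossLine r t i.2.2.1 u fun u => F ((i.2.1, i.2.2.2) :: u)) := by
      intro e1 n' d1
      rw [← sixRow_sum]
      refine sixRow_congr _ _ _ _ _ fun u hu => ?_
      have : u.isEmpty = l.isEmpty := by cases u <;> cases l <;> simp_all
      rw [crossLine_cons, this]
    simp only [diagRow, sixRow, ih, tripleWeight, key, List.isEmpty_cons]
    -- Both sides now sum the same products over boolean states; with the factors opaque, expanding
    -- the sums leaves only a commutative identity.
    generalize diagVertWeight r t l.isEmpty = D'
    generalize diagVertWeight r t false = D
    generalize horVertWeight r t false = V
    generalize sixWeight r 1 1 = H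
    generalize hS : (fun (n' d3 e n'' : Bool) => sixRow r t n' (q :: l) (fun u =>
            crossLine r t d3 u fun u => F ((e, n'') :: u))) = S
    have hS' : ∀ n' d3 e n'', sixRow r t n' (q :: l) (fun u =>
            crossLine r t d3 u fun u => F ((e, n'') :: u)) = S n' d3 e n'' := by
      intros; rw [← hS]
    simp only [hS', Fintype.sum_prod_type]
    simp only [Finset.mul_sum, Finset.sum_mul]
    simp only [Fintype.sum_bool]
    ring

/-- Here the line passes to the South-West, so its crossings come before those of the diagonal. The
star-triangle relation at each vertex brings it to the North-East. -/
theorem crossLine_sixRow {r t : ℝ} (hr : r * r = 2) (p : Bool × Bool) (l : States) :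
    ∀ (d n : Bool) (F : States → ℝ), crossLine r t d (p :: l) (fun u => sixRow r t n u F) =
      diagRow (tripleWeight r t) (tripleColumnWeight r t) d n (p :: l) F := by
  induction l generalizing p with
  | nil =>
    intro d n F
    simp only [diagRow, sixRow, crossLine, ← tripleColumnWeight_eq_southWest hr]
    simp
    ring
  | cons q l ih =>
    intro d n F
    have key : ∀ h1 v1 d2, crossLine r t d2 (q :: l) (fun u => sixRow r t n ((h1, v1) :: u) F) =
        ∑ i : Bool × Bool, horVertWeight r t false h1 n i.1 v1 *
          crossLine r t d2 (q :: l) (fun u => sixRow r t i.2 u fun u => F ((i.1, i.2) :: u)) := by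
      intro h1 v1 d2
      rw [← crossLine_sum]
      refine crossLine_congr _ _ _ _ fun u hu => ?_
      cases u with
      | nil => simp at hu
      | cons a u => simp only [sixRow, Fintype.sum_prod_type]
    simp only [diagRow, ← tripleWeight_eq_southWest hr, ← ih]
    rw [crossLine]
    simp only [key, List.isEmpty_cons, Fintype.sum_prod_type]
    generalize diagVertWeight r t false = D
    generalize horVertWeight r t false = V
    generalize sixWeight r 1 1 = H
    simp only [Finset.mul_sum, Finset.sum_mul]
    simp only [Fintype.sum_bool]
    ring

/-! ### Removing the diagonal lines from the triangle. -/

/-- The partition function of the triangle of size `k` with the vertex weights `w` and `w0`, as a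
function of the states on its diagonal side. -/
def diagPartition (w : Bool → Bool → Bool → Bool → Bool → Bool → ℝ)
    (w0 : Bool → Bool → Bool → Bool → ℝ) : ℕ → States → ℝ
  | 0, _ => 1
  | k + 1, l => diagRow w w0 false false l (diagPartition w w0 k)

/-- The partition function of the triangle of size `k` without diagonal lines. -/
noncomputable def sixPartition (r t : ℝ) : ℕ → States → ℝ
  | 0, _ => 1
  | k + 1, l => sixRow r t false l (sixPartition r t k)

/-- The line on the outer diagonal is passed to the next diagonal, and so on by induction until it
leaves the triangle. Each passage costs `r * r = 2`: one `r` from the empty first crossing and one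
from the empty last crossing. The smallest triangle contributes `1 + t`. -/
theorem diagRow_sixPartition {r t : ℝ} (hr : r * r = 2) (k : ℕ) :
    ∀ l : States, l.length = k + 1 →
      diagRow (tripleWeight r t) (tripleColumnWeight r t) false false l (sixPartition r t k) =
        2 ^ k * (1 + t) * sixPartition r t (k + 1) l := by
  induction k with
  | zero =>
    intro l hl
    match l, hl with
    | [p], _ =>
      rw [diagRow_eq_sixRow_crossLine]
      simp [sixPartition, sixRow, diagVertWeight, crossLine, sixWeight]
      linear_combination (1 + t) / 2 * horVertWeight r t true p.1 false false p.2 * hr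
  | succ k ih =>
    intro l hl
    match l, hl with
    | p :: q :: l, hl =>
      rw [diagRow_eq_sixRow_crossLine]
      have hl' : l.length = k := by simpa using hl
      have key : sixRow r t false (p :: q :: l)
          (fun u => crossLine r t false u (sixPartition r t (k + 1))) =
          2 ^ k * (1 + t) * sixPartition r t (k + 2) (p :: q :: l) := by
        rw [sixPartition]
        have := sixRow_sum (r := r) (t := t) {()} (p :: q :: l) false
          (fun _ => 2 ^ k * (1 + t)) (fun _ => sixPartition r t (k + 1))
        simp only [Finset.sum_singleton] at this
        rw [← this]
        refine sixRow_congr _ _ _ _ _ fun u hu => ?_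
        rw [← ih u (by simpa [hl'] using hu)]
        match u, hu with
        | a :: u, _ => exact crossLine_sixRow hr _ _ _ _ _
      simp only [Fintype.sum_bool, List.isEmpty_cons, key]
      simp [diagVertWeight, sixWeight]
      linear_combination (2 ^ k * (1 + t) * sixPartition r t (k + 2) (p :: q :: l)) * hr

/-- The diagonal lines can be removed from the triangle. -/
theorem diagPartition_eq_sixPartition {r t : ℝ} (hr : r * r = 2) (ht : 1 + t ≠ 0) (k : ℕ) :
    ∀ l : States, l.length = k →
      diagPartition twentyWeight (columnWeight t) k l = sixPartition r t k l := by
  induction k with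
  | zero => intro l _; rfl
  | succ k ih =>
    intro l hl
    match l, hl with
    | p :: l, hl =>
      have hl' : l.length = k := by simpa using hl
      -- The scalar produced by expelling the line equals the normalisation of the resolved row, one
      -- factor 2 for each of its `k` bulk vertices and `1 + t` for the last, so both cancel.
      have h1 := diagRow_sixPartition (t := t) hr k (p :: l) hl
      rw [diagRow_smul (tripleWeight_eq hr) (tripleColumnWeight_eq hr), hl'] at h1
      rw [diagPartition, diagRow_congr _ _ _ _ _ (sixPartition r t k)
        fun u hu => ih u (hu.trans hl')]
      exact mul_left_cancel₀ (mul_ne_zero (by positivity) ht) h1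

/-! ### The frozen outer diagonal in even size. -/

theorem sixRow_true_cons_horizontal {r t : ℝ} (l : States) (F : States → ℝ) :
    sixRow r t true ((true, false) :: l) F = 0 := by
  cases l <;> simp [sixRow, horVertWeight, sixWeight]

theorem sixRow_false_cons_vertical {r t : ℝ} (l : States) (F : States → ℝ) :
    sixRow r t false ((false, true) :: l) F = 0 := by
  cases l <;> simp [sixRow, horVertWeight, sixWeight]

theorem sixRow_true_replicate {r t : ℝ} (k : ℕ) : ∀ F : States → ℝ,
    sixRow r t true (List.replicate (k + 1) (false, true)) F =
      r ^ k * (r * (1 + t) / 2) * F (List.replicate k (false, true)) := by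
  induction k with
  | zero => intro F; simp [sixRow, horVertWeight, sixWeight]
  | succ k ih =>
    intro F
    have : sixRow r t true (List.replicate (k + 2) (false, true)) F =
        r * sixRow r t true (List.replicate (k + 1) (false, true))
          (fun u => F ((false, true) :: u)) := by
      simp [List.replicate_succ, sixRow, horVertWeight, sixWeight, sixRow_false_cons_vertical]
    rw [this, ih, List.replicate_succ]
    ring

/-- Conservation at each vertex leaves one configuration: horizontal steps go straight through the
first block, vertical steps through the second, each with weight `r` (deformed in the last column).
The outgoing `(true, true)` appears at the junction of the blocks. -/
theorem sixRow_false_replicate {r t : ℝ} (k j : ℕ) : ∀ F : States → ℝ,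
    sixRow r t false (List.replicate (k + 1) (true, false) ++
        List.replicate (j + 1) (false, true)) F =
      r ^ (k + 1) * (r ^ j * (r * (1 + t) / 2)) * F (List.replicate k (true, false) ++
        (true, true) :: List.replicate j (false, true)) := by
  induction k with
  | zero =>
    intro F
    have : sixRow r t false ((true, false) :: List.replicate (j + 1) (false, true)) F =
        r * sixRow r t true (List.replicate (j + 1) (false, true))
          (fun u => F ((true, true) :: u)) := by
      simp [List.replicate_succ, sixRow, horVertWeight, sixWeight, sixRow_false_cons_vertical]
    simp only [zero_add, List.replicate_one, List.replicate_zero, List.singleton_append,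
      List.nil_append]
    rw [this, sixRow_true_replicate]
    ring
  | succ k ih =>
    intro F
    have : sixRow r t false (List.replicate (k + 2) (true, false) ++
          List.replicate (j + 1) (false, true)) F =
        r * sixRow r t false (List.replicate (k + 1) (true, false) ++
          List.replicate (j + 1) (false, true)) (fun u => F ((true, false) :: u)) := by
      simp [List.replicate_succ, sixRow, horVertWeight, sixWeight, sixRow_true_cons_horizontal]
    rw [this, ih]
    simp only [List.replicate_succ, List.cons_append]
    ring

theorem diagPartition_even {t : ℝ} (ht : 1 + t ≠ 0) (k : ℕ) :
    diagPartition twentyWeight (columnWeight t) (2 * k + 2)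
        (List.replicate (k + 1) (true, false) ++ List.replicate (k + 1) (false, true)) =
      2 ^ k * (1 + t) * diagPartition twentyWeight (columnWeight t) (2 * k + 1)
        (List.replicate k (true, false) ++ (true, true) :: List.replicate k (false, true)) := by
  have hr : √2 * √2 = (2 : ℝ) := by norm_num
  rw [diagPartition_eq_sixPartition hr ht _ _ (by simp; ring),
    diagPartition_eq_sixPartition hr ht _ _ (by simp; ring), sixPartition,
    sixRow_false_replicate]
  have : √2 ^ (k + 1) * (√2 ^ k * (√2 * (1 + t) / 2)) = 2 ^ k * (1 + t) := by
    have h2 : √2 ^ k * √2 ^ k = (2 : ℝ) ^ k := by rw [← mul_pow, hr]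
    rw [pow_succ]
    linear_combination (1 + t) * h2 + √2 ^ k * √2 ^ k * (1 + t) / 2 * hr
  rw [this]

/-! ### Sums over the states of a list of edges. -/

/-- The set `P` after the membership of `e` has been set to `b`. -/
def updateEdge (P : Finset Edge) (e : Edge) (b : Bool) : Finset Edge :=
  if b then insert e P else P.erase e

theorem mem_updateEdge {P : Finset Edge} {e e' : Edge} {b : Bool} :
    e' ∈ updateEdge P e b ↔ if e' = e then b = true else e' ∈ P := by
  cases b <;> by_cases h : e' = e <;> simp [updateEdge, h]

/-- The sum of `f` over all modifications of `P` at the edges of the list. -/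
def sumEdges : List Edge → (Finset Edge → ℝ) → Finset Edge → ℝ
  | [], f, P => f P
  | e :: L, f, P => ∑ b : Bool, sumEdges L f (updateEdge P e b)

theorem sumEdges_congr (L : List Edge) {f g : Finset Edge → ℝ} (P : Finset Edge)
    (h : ∀ Q : Finset Edge, (∀ e, e ∉ L → (e ∈ Q ↔ e ∈ P)) → f Q = g Q) :
    sumEdges L f P = sumEdges L g P := by
  induction L generalizing P with
  | nil => exact h P (by simp)
  | cons e L ih =>
    refine Finset.sum_congr rfl fun b _ => ih _ fun Q hQ => h Q fun e' he' => ?_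
    rw [List.mem_cons, not_or] at he'
    rw [hQ e' he'.2, mem_updateEdge, if_neg he'.1]

theorem sumEdges_const_mul (L : List Edge) (c : ℝ) (f : Finset Edge → ℝ) (P : Finset Edge) :
    sumEdges L (fun Q => c * f Q) P = c * sumEdges L f P := by
  induction L generalizing P with
  | nil => rfl
  | cons e L ih => simp only [sumEdges, ih, Finset.mul_sum]

theorem sumEdges_append (L L' : List Edge) (f : Finset Edge → ℝ) (P : Finset Edge) :
    sumEdges (L ++ L') f P = sumEdges L (sumEdges L' f) P := by
  induction L generalizing P with
  | nil => rfl
  | cons e L ih => simp only [sumEdges, List.cons_append, ih]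

/-- As `L` has no repetition, the iterated sum reaches each set that agrees with `P` off `L` exactly
once. This links transfer operators to the counting of configurations. -/
theorem sumEdges_eq_sum_powerset {U : Finset Edge} (L : List Edge) (hL : L.Nodup)
    (hLU : ∀ e ∈ L, e ∈ U) (f : Finset Edge → ℝ) (P : Finset Edge) (hP : P ⊆ U) :
    sumEdges L f P = ∑ Q ∈ U.powerset with ∀ e ∈ U, e ∉ L → (e ∈ Q ↔ e ∈ P), f Q := by
  induction L generalizing P with
  | nil =>
    have : (U.powerset.filter fun Q => ∀ e ∈ U, e ∉ ([] : List Edge) → (e ∈ Q ↔ e ∈ P)) = {P} := by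
      ext Q
      simp only [Finset.mem_filter, Finset.mem_powerset, Finset.mem_singleton]
      constructor
      · rintro ⟨hQ, h⟩
        ext e
        constructor
        · exact fun he => (h e (hQ he) (by simp)).1 he
        · exact fun he => (h e (hP he) (by simp)).2 he
      · rintro rfl
        exact ⟨hP, by simp⟩
    rw [this, Finset.sum_singleton, sumEdges]
  | cons e L ih =>
    have heU : e ∈ U := hLU e (by simp)
    rw [List.nodup_cons] at hL
    have hsub : ∀ b, updateEdge P e b ⊆ U := by
      intro b e' he'
      rw [mem_updateEdge] at he'
      split_ifs at he' with h
      · exact h ▸ heU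
      · exact hP he'
    have key : ∀ b, sumEdges L f (updateEdge P e b) =
        ∑ Q ∈ U.powerset with (∀ e' ∈ U, e' ∉ e :: L → (e' ∈ Q ↔ e' ∈ P)) ∧ (e ∈ Q ↔ b = true),
          f Q := by
      intro b
      rw [ih hL.2 (fun e he => hLU e (by simp [he])) _ (hsub b)]
      congr 1
      refine Finset.filter_congr fun Q _ => ⟨fun h => ⟨fun e' he' hn => ?_, ?_⟩, ?_⟩
      · rw [List.mem_cons, not_or] at hn
        rw [h e' he' hn.2, mem_updateEdge, if_neg hn.1]
      · rw [h e heU hL.1, mem_updateEdge, if_pos rfl]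
      · rintro ⟨h1, h2⟩ e' he' hn
        rw [mem_updateEdge]
        split_ifs with h
        · rw [h, h2]
        · exact h1 e' he' (by simp [h, hn])
    rw [sumEdges, Fintype.sum_bool, key, key, ← Finset.filter_filter, ← Finset.filter_filter]
    simp only [Bool.false_eq_true, iff_false, iff_true]
    exact Finset.sum_filter_add_sum_filter_not _ _ _

/-! ### Vertices and edges of the triangle, sliced along its diagonals. -/

/-- The weight of the vertex `p` of a configuration. -/
def vertexWeight (t : ℝ) (P : Finset Edge) (p : ℤ × ℤ) : ℝ :=
  if p.1 = 0 then
    columnWeight t (edgeTo .horizontal p ∈ P) (edgeTo .diagonal p ∈ P) (edgeTo .vertical p ∈ P)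
      (edgeFrom .vertical p ∈ P)
  else
    twentyWeight (edgeTo .horizontal p ∈ P) (edgeTo .diagonal p ∈ P) (edgeTo .vertical p ∈ P)
      (edgeFrom .horizontal p ∈ P) (edgeFrom .diagonal p ∈ P) (edgeFrom .vertical p ∈ P)

theorem vertexWeight_congr {t : ℝ} {P Q : Finset Edge} {p : ℤ × ℤ}
    (h : ∀ d, (edgeTo d p ∈ P ↔ edgeTo d p ∈ Q) ∧ (edgeFrom d p ∈ P ↔ edgeFrom d p ∈ Q)) :
    vertexWeight t P p = vertexWeight t Q p := by
  simp only [vertexWeight, h]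

/-- The states of the West and South edges of `k` consecutive vertices of a diagonal. -/
def southWestStates (P : Finset Edge) : ℤ → ℤ → ℕ → States
  | _, _, 0 => []
  | a, b, k + 1 => (decide (edgeTo .horizontal (a, b) ∈ P), decide (edgeFrom .vertical (a, b) ∈ P)) ::
      southWestStates P (a + 1) (b - 1) k

/-- The vertices of a diagonal. -/
def diagVertices : ℤ → ℤ → ℕ → List (ℤ × ℤ)
  | _, _, 0 => []
  | a, b, k + 1 => (a, b) :: diagVertices (a + 1) (b - 1) k

/-- The edges of a diagonal with `k + 1` vertices, and those which leave it to the North-East,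
except at its ends. -/
def diagEdges : ℤ → ℤ → ℕ → List Edge
  | _, _, 0 => []
  | a, b, k + 1 => edgeFrom .horizontal (a, b) :: edgeFrom .diagonal (a, b) ::
      edgeTo .vertical (a + 1, b - 1) :: diagEdges (a + 1) (b - 1) k

/-- The vertices of the triangle of size `k` with top row at height `b`. -/
def triangleVertices (b : ℤ) : ℕ → List (ℤ × ℤ)
  | 0 => []
  | k + 1 => diagVertices (-k) b (k + 1) ++ triangleVertices b k

/-- The internal edges of the triangle of size `k` with top row at height `b`. -/
def triangleEdges (b : ℤ) : ℕ → List Edge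
  | 0 => []
  | k + 1 => diagEdges (-k) b k ++ triangleEdges b k

theorem mem_diagVertices {k : ℕ} {a b x y : ℤ} :
    (x, y) ∈ diagVertices a b k ↔ x + y = a + b ∧ a ≤ x ∧ x < a + k := by
  induction k generalizing a b with
  | zero => simp only [diagVertices, List.not_mem_nil, false_iff]; omega
  | succ k ih => simp only [diagVertices, List.mem_cons, ih, Prod.mk.injEq]; omega

theorem nodup_diagVertices {k : ℕ} {a b : ℤ} : (diagVertices a b k).Nodup := by
  induction k generalizing a b with
  | zero => simp [diagVertices]
  | succ k ih =>
    rw [diagVertices, List.nodup_cons, mem_diagVertices]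
    exact ⟨by omega, ih⟩

theorem mem_triangleVertices {k : ℕ} {b x y : ℤ} :
    (x, y) ∈ triangleVertices b k ↔ b + 1 - k ≤ x + y ∧ x ≤ 0 ∧ y ≤ b := by
  induction k with
  | zero => simp only [triangleVertices, List.not_mem_nil, false_iff]; omega
  | succ k ih => simp only [triangleVertices, List.mem_append, mem_diagVertices, ih]; omega

theorem nodup_triangleVertices {k : ℕ} {b : ℤ} : (triangleVertices b k).Nodup := by
  induction k with
  | zero => simp [triangleVertices]
  | succ k ih =>
    refine List.Nodup.append nodup_diagVertices ih ?_
    rintro ⟨x, y⟩ h1 h2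
    rw [mem_diagVertices] at h1
    rw [mem_triangleVertices] at h2
    omega

theorem toFinset_triangleVertices (m : ℕ) :
    (triangleVertices ((m : ℤ) - 1) m).toFinset = vertices m := by
  ext ⟨x, y⟩
  simp only [List.mem_toFinset, mem_triangleVertices, vertices, Finset.mem_filter,
    Finset.mem_product, Finset.mem_Icc]
  omega

/-- The range of the position of the edges in `diagEdges`. -/
def InDiag (k : ℕ) (a b : ℤ) : Edge → Prop
  | (.horizontal, (x, y)) => x + y = a + b ∧ a ≤ x ∧ x < a + k
  | (.diagonal, (x, y)) => x + y = a + b ∧ a ≤ x ∧ x < a + k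
  | (.vertical, (x, y)) => x + y = a + b + 1 ∧ a < x ∧ x ≤ a + k

/-- The range of the position of the edges in `triangleEdges`. -/
def InTriangle (k : ℕ) (b : ℤ) : Edge → Prop
  | (.horizontal, (x, y)) => b + 1 - k ≤ x + y ∧ x < 0 ∧ y ≤ b
  | (.diagonal, (x, y)) => b + 1 - k ≤ x + y ∧ x < 0 ∧ y ≤ b
  | (.vertical, (x, y)) => b + 2 - k ≤ x + y ∧ x ≤ 0 ∧ y ≤ b

theorem mem_diagEdges {k : ℕ} {a b : ℤ} {e : Edge} : e ∈ diagEdges a b k ↔ InDiag k a b e := by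
  obtain ⟨d, x, y⟩ := e
  induction k generalizing a b with
  | zero => cases d <;> simp only [diagEdges, List.not_mem_nil, false_iff, InDiag] <;> omega
  | succ k ih =>
    cases d <;> simp [diagEdges, ih, InDiag, edgeTo, edgeFrom, step] <;> omega

theorem nodup_diagEdges {k : ℕ} {a b : ℤ} : (diagEdges a b k).Nodup := by
  induction k generalizing a b with
  | zero => simp [diagEdges]
  | succ k ih =>
    simp [diagEdges, ih, mem_diagEdges, InDiag, edgeTo, edgeFrom, step]

theorem mem_triangleEdges {k : ℕ} {b : ℤ} {e : Edge} :
    e ∈ triangleEdges b k ↔ InTriangle k b e := by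
  obtain ⟨d, x, y⟩ := e
  induction k with
  | zero => cases d <;> simp only [triangleEdges, List.not_mem_nil, false_iff, InTriangle] <;> omega
  | succ k ih =>
    cases d <;> simp [triangleEdges, ih, mem_diagEdges, InDiag, InTriangle] <;> omega

theorem nodup_triangleEdges {k : ℕ} {b : ℤ} : (triangleEdges b k).Nodup := by
  induction k with
  | zero => simp [triangleEdges]
  | succ k ih =>
    refine List.Nodup.append nodup_diagEdges ih ?_
    rintro ⟨d, x, y⟩ h1 h2
    rw [mem_diagEdges] at h1
    rw [mem_triangleEdges] at h2
    cases d <;> simp only [InDiag, InTriangle] at h1 h2 <;> omega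

theorem southWestStates_congr {P Q : Finset Edge} {k : ℕ} {a b : ℤ}
    (h : ∀ x y, x + y = a + b → a ≤ x →
      (edgeTo .horizontal (x, y) ∈ P ↔ edgeTo .horizontal (x, y) ∈ Q) ∧
      (edgeFrom .vertical (x, y) ∈ P ↔ edgeFrom .vertical (x, y) ∈ Q)) :
    southWestStates P a b k = southWestStates Q a b k := by
  induction k generalizing a b with
  | zero => rfl
  | succ k ih =>
    rw [southWestStates, southWestStates, ih fun x y h1 h2 => h x y (by omega) (by omega)]
    simp only [h a b rfl le_rfl]

/-! ### The partition function as a sum over internal edges. -/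

/-- The transfer operator of a diagonal as a sum over the states of its edges. -/
theorem diagRow_southWestStates (t : ℝ) (k : ℕ) : ∀ (a b : ℤ) (P : Finset Edge) (F : States → ℝ),
    a = -k →
    diagRow twentyWeight (columnWeight t) (edgeTo .diagonal (a, b) ∈ P) (edgeTo .vertical (a, b) ∈ P)
        (southWestStates P a b (k + 1)) F =
      sumEdges (diagEdges a b k) (fun Q =>
        ((diagVertices a b (k + 1)).map (vertexWeight t Q)).prod *
          F (southWestStates Q (a + 1) b k)) P := by
  induction k with
  | zero =>
    intro a b P F ha
    simp at ha
    subst ha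
    simp [southWestStates, diagRow, diagEdges, sumEdges, diagVertices, vertexWeight]
  | succ k ih =>
    intro a b P F ha
    have ha' : a + 1 = -(k : ℤ) := by rw [ha]; push_cast; ring
    rw [southWestStates, southWestStates, diagRow]
    simp only [diagEdges, sumEdges]
    refine Finset.sum_congr rfl fun e _ => Finset.sum_congr rfl fun d' _ =>
      Finset.sum_congr rfl fun n' _ => ?_
    set P' := updateEdge (updateEdge (updateEdge P (edgeFrom .horizontal (a, b)) e)
      (edgeFrom .diagonal (a, b)) d') (edgeTo .vertical (a + 1, b - 1)) n' with hP'
    have hmem : ∀ e', e' ∈ P' ↔ if e' = edgeTo .vertical (a + 1, b - 1) then n' = true else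
        if e' = edgeFrom .diagonal (a, b) then d' = true else
        if e' = edgeFrom .horizontal (a, b) then e = true else e' ∈ P := by
      intro e'
      simp only [hP', mem_updateEdge]
    have ih' := ih (a + 1) (b - 1) P' (fun u => F ((e, n') :: u)) ha'
    have h1 : southWestStates P' (a + 1) (b - 1) (k + 1) =
        southWestStates P (a + 1) (b - 1) (k + 1) := by
      refine southWestStates_congr fun x y h1 h2 => ?_
      simp only [hmem, edgeTo, edgeFrom, step]
      simp
      constructor
      · intro h; omega
      · intro h; omega
    have h2 : edgeTo .diagonal (a + 1, b - 1) ∈ P' ↔ d' = true := by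
      simp [hmem, edgeTo, edgeFrom, step]
    have h3 : edgeTo .vertical (a + 1, b - 1) ∈ P' ↔ n' = true := by
      simp [hmem]
    rw [h1] at ih'
    simp only [h2, h3, Bool.decide_eq_true] at ih'
    rw [southWestStates] at ih'
    rw [ih', ← sumEdges_const_mul]
    refine sumEdges_congr _ _ fun Q hQ => ?_
    have hQ1 : ∀ e, ¬ InDiag k (a + 1) (b - 1) e → (e ∈ Q ↔ e ∈ P') :=
      fun e he => hQ e (by rwa [mem_diagEdges])
    have q1 : edgeTo .horizontal (a, b) ∈ Q ↔ edgeTo .horizontal (a, b) ∈ P := by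
      rw [hQ1 _ (by simp [InDiag, edgeTo, step]), hmem]
      simp [edgeTo, edgeFrom, step]
    have q2 : edgeTo .diagonal (a, b) ∈ Q ↔ edgeTo .diagonal (a, b) ∈ P := by
      rw [hQ1 _ (by simp [InDiag, edgeTo, step]), hmem]
      simp [edgeTo, edgeFrom, step]
    have q3 : edgeTo .vertical (a, b) ∈ Q ↔ edgeTo .vertical (a, b) ∈ P := by
      rw [hQ1 _ (by simp [InDiag, edgeTo, step]), hmem]
      simp [edgeTo, edgeFrom, step]
    have q4 : edgeFrom .horizontal (a, b) ∈ Q ↔ e = true := by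
      rw [hQ1 _ (by simp [InDiag, edgeFrom]), hmem]
      simp [edgeTo, edgeFrom, step]
    have q5 : edgeFrom .diagonal (a, b) ∈ Q ↔ d' = true := by
      rw [hQ1 _ (by simp [InDiag, edgeFrom]), hmem]
      simp [edgeTo, edgeFrom, step]
    have q6 : edgeFrom .vertical (a, b) ∈ Q ↔ edgeFrom .vertical (a, b) ∈ P := by
      rw [hQ1 _ (by simp [InDiag, edgeFrom]), hmem]
      simp [edgeTo, edgeFrom, step]
    have q7 : edgeFrom .vertical (a + 1, b) ∈ Q ↔ n' = true := by
      rw [hQ1 _ (by simp [InDiag, edgeFrom]), hmem]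
      simp [edgeTo, edgeFrom, step]
    have q8 : edgeTo .horizontal (a + 1, b) ∈ Q ↔ e = true := by
      simpa [edgeTo, edgeFrom, step] using q4
    -- At least one vertex follows on this diagonal, so `(a, b)` lies off the rightmost column and
    -- has the bulk weight.
    have ha0 : a ≠ 0 := by omega
    have hprod : ((diagVertices a b (k + 1 + 1)).map (vertexWeight t Q)).prod =
        vertexWeight t Q (a, b) *
          ((diagVertices (a + 1) (b - 1) (k + 1)).map (vertexWeight t Q)).prod := by
      rw [diagVertices, List.map_cons, List.prod_cons]
    have hw : vertexWeight t Q (a, b) = twentyWeight (edgeTo .horizontal (a, b) ∈ P)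
        (edgeTo .diagonal (a, b) ∈ P) (edgeTo .vertical (a, b) ∈ P) e d'
        (edgeFrom .vertical (a, b) ∈ P) := by
      simp only [vertexWeight, if_neg ha0, q1, q2, q3, q4, q5, q6, Bool.decide_eq_true]
    have hs : southWestStates Q (a + 1) b (k + 1) =
        (e, n') :: southWestStates Q (a + 1 + 1) (b - 1) k := by
      simp only [southWestStates, q7, q8, Bool.decide_eq_true]
    rw [hprod, hw, hs]
    ring

/-- The partition function of the triangle as a sum over the states of its internal edges. -/
theorem diagPartition_southWestStates (t : ℝ) (b : ℤ) (k : ℕ) : ∀ P : Finset Edge,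
    (∀ x, edgeTo .diagonal (x, b) ∉ P ∧ edgeTo .vertical (x, b) ∉ P) →
    diagPartition twentyWeight (columnWeight t) k (southWestStates P (1 - k) b k) =
      sumEdges (triangleEdges b k)
        (fun Q => ((triangleVertices b k).map (vertexWeight t Q)).prod) P := by
  induction k with
  | zero => intro P _; simp [diagPartition, triangleEdges, sumEdges, triangleVertices]
  | succ k ih =>
    intro P hP
    have h := diagRow_southWestStates t k (-k) b P
      (diagPartition twentyWeight (columnWeight t) k) rfl
    simp only [hP, decide_false] at h
    have hk : 1 - ((k + 1 : ℕ) : ℤ) = -k := by push_cast; ring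
    rw [diagPartition, hk, h, triangleEdges, sumEdges_append]
    refine sumEdges_congr _ _ fun Q hQ => ?_
    rw [neg_add_eq_sub, ih Q, ← sumEdges_const_mul]
    · refine sumEdges_congr _ _ fun Q' hQ' => ?_
      rw [triangleVertices, List.map_append, List.prod_append]
      congr 2
      refine List.map_congr_left ?_
      rintro ⟨x, y⟩ hxy
      rw [mem_diagVertices] at hxy
      -- Summing over the smaller triangle does not disturb the outer diagonal, since no edge at its
      -- vertices is internal to the smaller triangle.
      have key : ∀ e, ¬ InTriangle k b e → (e ∈ Q ↔ e ∈ Q') :=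
        fun e he => (hQ' e (by rwa [mem_triangleEdges])).symm
      refine vertexWeight_congr fun d => ⟨key _ ?_, key _ ?_⟩ <;> cases d <;>
        simp only [InTriangle, edgeTo, edgeFrom, step, Prod.mk_sub_mk] <;> omega
    · intro x
      have hd : edgeTo .diagonal (x, b) ∉ diagEdges (-k) b k := by
        rw [mem_diagEdges]; simp only [InDiag, edgeTo, step, Prod.mk_sub_mk]; omega
      have hv : edgeTo .vertical (x, b) ∉ diagEdges (-k) b k := by
        rw [mem_diagEdges]; simp only [InDiag, edgeTo, step, Prod.mk_sub_mk]; omega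
      rw [hQ _ hd, hQ _ hv]
      exact hP x

/-! ### The ice rule as conservation of paths, and the rightmost column. -/

theorem mem_vertices {m : ℕ} {x y : ℤ} :
    (x, y) ∈ vertices m ↔ 0 ≤ x + y ∧ x ≤ 0 ∧ y ≤ (m : ℤ) - 1 := by
  simp only [vertices, Finset.mem_filter, Finset.mem_product, Finset.mem_Icc]
  omega

theorem mem_edges {m : ℕ} {e : Edge} :
    e ∈ edges m ↔ ∃ p ∈ vertices m, ∃ d, edgeTo d p = e ∨ edgeFrom d p = e := by
  simp [edges, exists_or]

theorem edgeTo_mem_edges {m : ℕ} {p : ℤ × ℤ} (d : Dir) (hp : p ∈ vertices m) :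
    edgeTo d p ∈ edges m := mem_edges.2 ⟨p, hp, d, Or.inl rfl⟩

theorem edgeFrom_mem_edges {m : ℕ} {p : ℤ × ℤ} (d : Dir) (hp : p ∈ vertices m) :
    edgeFrom d p ∈ edges m := mem_edges.2 ⟨p, hp, d, Or.inr rfl⟩

theorem card_filter_dir (q : Dir → Prop) [DecidablePred q] :
    (Finset.univ.filter q).card = (decide (q .horizontal)).toNat + (decide (q .diagonal)).toNat +
      (decide (q .vertical)).toNat := by
  have huniv : (Finset.univ : Finset Dir) = {.horizontal, .diagonal, .vertical} := rfl
  rw [Finset.card_filter, huniv, Finset.sum_insert (by decide), Finset.sum_insert (by decide),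
    Finset.sum_singleton, add_assoc]
  by_cases h1 : q .horizontal <;> by_cases h2 : q .diagonal <;> by_cases h3 : q .vertical <;>
    simp [h1, h2, h3]

theorem iceRule_iff {P : Finset Edge} {p : ℤ × ℤ} : IceRule P p ↔
    (decide (edgeTo .horizontal p ∈ P)).toNat + (decide (edgeTo .diagonal p ∈ P)).toNat +
        (decide (edgeTo .vertical p ∈ P)).toNat =
      (decide (edgeFrom .horizontal p ∈ P)).toNat + (decide (edgeFrom .diagonal p ∈ P)).toNat +
        (decide (edgeFrom .vertical p ∈ P)).toNat := by
  have h : ∀ b : Bool, (!b).toNat = 1 - b.toNat := by decide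
  simp only [IceRule, numIncoming, numOutgoing, card_filter_dir, decide_not, h]
  have := Bool.toNat_le (decide (edgeTo .horizontal p ∈ P))
  have := Bool.toNat_le (decide (edgeTo .diagonal p ∈ P))
  have := Bool.toNat_le (decide (edgeTo .vertical p ∈ P))
  have := Bool.toNat_le (decide (edgeFrom .horizontal p ∈ P))
  have := Bool.toNat_le (decide (edgeFrom .diagonal p ∈ P))
  have := Bool.toNat_le (decide (edgeFrom .vertical p ∈ P))
  omega

/-- An antitone sequence of propositions which starts with a true one and contains a false one has
a last true one. -/
theorem exists_threshold (s : ℕ → Prop) (m : ℕ) (h0 : s 0) (hm : ¬ s m)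
    (h : ∀ y < m, s (y + 1) → s y) : ∃ K < m, ∀ y ≤ m, s y ↔ y ≤ K := by
  induction m with
  | zero => exact absurd h0 hm
  | succ m ih =>
    by_cases hs : s m
    · refine ⟨m, by omega, fun y hy => ?_⟩
      have key : ∀ j ≤ m, s (m - j) := by
        intro j
        induction j with
        | zero => intro _; exact hs
        | succ j ihj =>
          intro hj
          refine h _ (by omega) ?_
          rw [show m - (j + 1) + 1 = m - j by omega]
          exact ihj (by omega)
      constructor
      · intro hsy
        by_contra hlt
        exact hm (by rwa [show y = m + 1 by omega] at hsy)
      · intro hle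
        have := key (m - y) (by omega)
        rwa [show m - (m - y) = y by omega] at this
    · obtain ⟨K, hK, hs'⟩ := ih hs fun y hy => h y (by omega)
      refine ⟨K, by omega, fun y hy => ?_⟩
      rcases Nat.lt_or_ge m y with hlt | hge
      · rw [show y = m + 1 by omega]
        exact ⟨fun h' => absurd h' hm, fun h' => by omega⟩
      · exact hs' y hge

theorem edgeTo_vertical_column (y : ℤ) :
    edgeTo .vertical (0, y) = edgeFrom .vertical (0, y + 1) := by
  simp [edgeTo, edgeFrom, step]

/-- In the second and third models a single path arrives at the rightmost column, and then follows
it down to its bottom. -/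
theorem IsConfig.exists_column {i : Model} (hi : i ≠ .V1) {m : ℕ} (hm : 1 ≤ m) {P : Finset Edge}
    (hP : IsConfig i m P) : ∃ K < m,
      (∀ y : ℕ, y ≤ m → (edgeFrom .vertical (0, (y : ℤ)) ∈ P ↔ y ≤ K)) ∧
      ∀ k : ℕ, 1 ≤ k → k ≤ m → (HasPosition i m k P ↔ k = K + 1) := by
  obtain ⟨-, hice, hbc⟩ := hP
  have hv : ∀ y : ℤ, 0 ≤ y → y ≤ (m : ℤ) - 1 → ((0 : ℤ), y) ∈ vertices m := by
    intro y h1 h2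
    rw [mem_vertices]
    omega
  have heast : ∀ y : ℤ, 0 ≤ y → y ≤ (m : ℤ) - 1 →
      edgeFrom .horizontal (0, y) ∉ P ∧ edgeFrom .diagonal (0, y) ∉ P := by
    intro y h1 h2
    have := ((hbc _ (hv y h1 h2)).2.1 rfl)
    cases i <;> simp_all [eastPath]
  have h0 : edgeFrom .vertical (0, 0) ∈ P := by
    have := ((hbc _ (hv 0 le_rfl (by omega))).2.2 (by simp)).2
    rw [this]
    cases i <;> simp_all [diagPath]
  have htop : edgeFrom .vertical (0, (m : ℤ)) ∉ P := by
    have := ((hbc _ (hv (m - 1) (by omega) le_rfl)).1 rfl).2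
    rw [edgeTo_vertical_column, sub_add_cancel] at this
    rw [this]
    cases i <;> simp only [northPath, not_false_eq_true]
    omega
  -- With empty East exits, conservation allows at most one path to enter a vertex of the column,
  -- and any such path must leave through the South edge.
  have hcol : ∀ y : ℤ, 0 ≤ y → y ≤ (m : ℤ) - 1 →
      (edgeFrom .vertical (0, y + 1) ∈ P → edgeFrom .vertical (0, y) ∈ P) ∧
      (Visited P (0, y) ↔ edgeFrom .vertical (0, y) ∈ P) := by
    intro y h1 h2
    have h3 := iceRule_iff.1 (hice _ (hv y h1 h2))
    have h4 := heast y h1 h2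
    rw [edgeTo_vertical_column] at h3
    simp only [h4, decide_false, Bool.toNat_false] at h3
    have h5 : Visited P (0, y) ↔ edgeTo .horizontal (0, y) ∈ P ∨ edgeTo .diagonal (0, y) ∈ P ∨
        edgeFrom .vertical (0, y + 1) ∈ P ∨ edgeFrom .vertical (0, y) ∈ P := by
      constructor
      · rintro ⟨d, h | h⟩ <;> cases d <;> simp_all [edgeTo_vertical_column]
      · rintro (h | h | h | h)
        · exact ⟨_, Or.inl h⟩
        · exact ⟨_, Or.inl h⟩
        · exact ⟨.vertical, Or.inl (by rwa [edgeTo_vertical_column])⟩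
        · exact ⟨_, Or.inr h⟩
    rw [h5]
    by_cases k1 : edgeTo .horizontal (0, y) ∈ P <;> by_cases k2 : edgeTo .diagonal (0, y) ∈ P <;>
      by_cases k3 : edgeFrom .vertical (0, y + 1) ∈ P <;>
      by_cases k4 : edgeFrom .vertical (0, y) ∈ P <;> simp_all
  obtain ⟨K, hK, hs⟩ := exists_threshold (fun y => edgeFrom .vertical (0, (y : ℤ)) ∈ P) m
    (by simpa using h0) htop
    (fun y hy => by simpa using (hcol y (by omega) (by omega)).1)
  refine ⟨K, hK, hs, fun k hk1 hkm => ?_⟩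
  have hvis : ∀ y : ℕ, y < m → (Visited P (0, (y : ℤ)) ↔ y ≤ K) := fun y hy =>
    ((hcol y (by omega) (by omega)).2).trans (hs y hy.le)
  have hpos : HasPosition i m k P ↔ Visited P (0, (k : ℤ) - 1) ∧
      ∀ y : ℤ, (k : ℤ) - 1 < y → y ≤ (m : ℤ) - 1 → ¬ Visited P (0, y) := by
    cases i <;> first | exact absurd rfl hi | rfl
  rw [hpos, show (k : ℤ) - 1 = ((k - 1 : ℕ) : ℤ) by omega, hvis _ (by omega)]
  constructor
  · rintro ⟨h1, h2⟩
    by_contra hne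
    exact h2 K (by omega) (by omega) ((hvis K hK).2 le_rfl)
  · rintro rfl
    refine ⟨by omega, fun y h1 h2 h3 => ?_⟩
    lift y to ℕ using by omega
    rw [hvis y (by omega)] at h3
    omega

/-! ### The boundary of the third model as a set of edges. -/

/-- The external edges that are path steps in the third model. -/
def ThirdBoundary (m : ℕ) : Edge → Prop
  | (.horizontal, (x, y)) => x + y = -1 ∧ (m : ℤ) - 1 ≤ 2 * y
  | (.diagonal, _) => False
  | (.vertical, (x, y)) => x + y = 0 ∧ 2 * y ≤ (m : ℤ) - 1

open Classical in
/-- The set of the external edges that are path steps in the third model. -/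
noncomputable def thirdBoundary (m : ℕ) : Finset Edge := (edges m).filter (ThirdBoundary m)

theorem thirdBoundary_subset {m : ℕ} : thirdBoundary m ⊆ edges m := by
  classical exact Finset.filter_subset _ _

theorem mem_thirdBoundary {m : ℕ} {e : Edge} (he : e ∈ edges m) :
    e ∈ thirdBoundary m ↔ ThirdBoundary m e := by
  simp [thirdBoundary, he]

theorem boundaryCondition_third_iff {m : ℕ} {P : Finset Edge} :
    BoundaryCondition .V3 m P ↔
      ∀ e ∈ edges m, e ∉ triangleEdges ((m : ℤ) - 1) m → (e ∈ P ↔ e ∈ thirdBoundary m) := by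
  constructor
  · intro h e he hn
    rw [mem_thirdBoundary he]
    rw [mem_triangleEdges] at hn
    obtain ⟨⟨x, y⟩, hp, d, hd⟩ := mem_edges.1 he
    have h1 := h _ hp
    rw [mem_vertices] at hp
    rcases hd with rfl | rfl <;> cases d <;>
      simp only [edgeTo, edgeFrom, step, InTriangle, ThirdBoundary, Prod.mk_sub_mk, northPath,
        eastPath, diagPath, iff_false] at hn h1 ⊢
    · rw [(h1.2.2 (by omega)).1]; omega
    · exact (h1.1 (by omega)).1
    · have := (h1.1 (by omega)).2
      simp only [this, false_iff]; omega
    · have := (h1.2.1 (by omega)).1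
      simp only [this, false_iff]; omega
    · exact (h1.2.1 (by omega)).2
    · rw [(h1.2.2 (by omega)).2]; omega
  · rintro h ⟨x, y⟩ hp
    have hto : ∀ d, ¬ InTriangle m ((m : ℤ) - 1) (edgeTo d (x, y)) →
        (edgeTo d (x, y) ∈ P ↔ ThirdBoundary m (edgeTo d (x, y))) := by
      intro d hd
      rw [← mem_thirdBoundary (edgeTo_mem_edges d hp)]
      exact h _ (edgeTo_mem_edges d hp) (by rwa [mem_triangleEdges])
    have hfrom : ∀ d, ¬ InTriangle m ((m : ℤ) - 1) (edgeFrom d (x, y)) →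
        (edgeFrom d (x, y) ∈ P ↔ ThirdBoundary m (edgeFrom d (x, y))) := by
      intro d hd
      rw [← mem_thirdBoundary (edgeFrom_mem_edges d hp)]
      exact h _ (edgeFrom_mem_edges d hp) (by rwa [mem_triangleEdges])
    rw [mem_vertices] at hp
    refine ⟨fun h1 => ⟨?_, ?_⟩, fun h1 => ⟨?_, ?_⟩, fun h1 => ⟨?_, ?_⟩⟩ <;>
      simp only at h1 <;> first | rw [hto] | rw [hfrom]
    all_goals
      simp only [edgeTo, edgeFrom, step, InTriangle, ThirdBoundary, Prod.mk_sub_mk, northPath,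
        eastPath, diagPath, iff_false]
    all_goals omega

theorem triangleEdges_subset {m : ℕ} {e : Edge} (he : e ∈ triangleEdges ((m : ℤ) - 1) m) :
    e ∈ edges m := by
  rw [mem_triangleEdges] at he
  obtain ⟨d, x, y⟩ := e
  cases d <;> simp only [InTriangle] at he
  · exact edgeFrom_mem_edges .horizontal (mem_vertices.2 (by omega))
  · exact edgeFrom_mem_edges .diagonal (mem_vertices.2 (by omega))
  · exact edgeFrom_mem_edges .vertical (mem_vertices.2 (by omega))

/-! ### The third model as a weighted partition function. -/

/-- The value of the refined generating polynomial at a real number. -/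
noncomputable def refinedValue (i : Model) (m : ℕ) (t : ℝ) : ℝ :=
  ∑ k ∈ Finset.Icc 1 m, (refinedCount i m k : ℝ) * t ^ (k - 1)

theorem vertexWeight_eq {t : ℝ} {m : ℕ} {P : Finset Edge} (hP : BoundaryCondition .V3 m P)
    {p : ℤ × ℤ} (hp : p ∈ vertices m) [Decidable (IceRule P p)] : vertexWeight t P p =
      if IceRule P p then (if p.1 = 0 ∧ edgeTo .vertical p ∈ P then t else 1) else 0 := by
  rw [vertexWeight]
  by_cases h0 : p.1 = 0
  · have hE : edgeFrom .horizontal p ∉ P ∧ edgeFrom .diagonal p ∉ P := by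
      simpa [eastPath] using (hP p hp).2.1 h0
    have h := iceRule_iff (P := P) (p := p)
    simp only [hE, decide_false, Bool.toNat_false, zero_add] at h
    by_cases hI : IceRule P p
    · simp [h0, columnWeight, hI, h.1 hI]
    · have hn := mt h.2 hI
      simp [h0, columnWeight, hI, hn]
  · have h := iceRule_iff (P := P) (p := p)
    by_cases hI : IceRule P p
    · simp [h0, twentyWeight, hI, h.1 hI]
    · have hn := mt h.2 hI
      simp [h0, twentyWeight, hI, hn]

theorem refinedValue_third (m : ℕ) (hm : 1 ≤ m) (t : ℝ) :
    refinedValue .V3 m t = diagPartition twentyWeight (columnWeight t) m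
      (southWestStates (thirdBoundary m) (1 - m) (m - 1) m) := by
  classical
  rw [diagPartition_southWestStates, sumEdges_eq_sum_powerset (U := edges m) _ nodup_triangleEdges
    (fun e => triangleEdges_subset) _ _ thirdBoundary_subset]
  · simp only [← boundaryCondition_third_iff]
    set c : Finset Edge → ℕ := fun P =>
      ((vertices m).filter fun p => p.1 = 0 ∧ edgeTo .vertical p ∈ P).card with hc
    have h1 : ∀ P ∈ (edges m).powerset.filter (BoundaryCondition .V3 m),
        ((triangleVertices ((m : ℤ) - 1) m).map (vertexWeight t P)).prod =
          if ∀ p ∈ vertices m, IceRule P p then t ^ c P else 0 := by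
      intro P hP
      rw [← List.prod_toFinset _ nodup_triangleVertices, toFinset_triangleVertices]
      rw [Finset.prod_congr rfl fun p hp => vertexWeight_eq (Finset.mem_filter.1 hP).2 hp,
        Finset.prod_ite_zero]
      congr 1
      rw [Finset.prod_ite, Finset.prod_const, Finset.prod_const_one, mul_one]
    rw [Finset.sum_congr rfl h1, ← Finset.sum_filter, Finset.filter_filter]
    have h2 : ∀ P ∈ (edges m).powerset.filter
        (fun P => BoundaryCondition .V3 m P ∧ ∀ p ∈ vertices m, IceRule P p),
        c P < m ∧ ∀ k, 1 ≤ k → k ≤ m → (HasPosition .V3 m k P ↔ c P + 1 = k) := by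
      intro P hP
      rw [Finset.mem_filter, Finset.mem_powerset] at hP
      obtain ⟨K, hK, hs, hpos⟩ := IsConfig.exists_column (i := .V3) (by simp) hm
        ⟨hP.1, hP.2.2, hP.2.1⟩
      -- The North edge at height `y` is the South edge at height `y + 1`, so exactly the heights
      -- `0, …, K - 1` carry a factor `t`; the exponent is the position minus one.
      have hcK : c P = K := by
        have : ((vertices m).filter fun p => p.1 = 0 ∧ edgeTo .vertical p ∈ P) =
            (Finset.range K).image fun y : ℕ => ((0 : ℤ), (y : ℤ)) := by
          ext ⟨x, y⟩
          simp only [Finset.mem_filter, mem_vertices, Finset.mem_image, Finset.mem_range,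
            Prod.mk.injEq]
          constructor
          · rintro ⟨h1, rfl, h3⟩
            lift y to ℕ using by omega
            rw [edgeTo_vertical_column] at h3
            have := (hs (y + 1) (by omega)).1 (by exact_mod_cast h3)
            exact ⟨y, by omega, rfl, rfl⟩
          · rintro ⟨z, hz, rfl, rfl⟩
            refine ⟨by omega, rfl, ?_⟩
            rw [edgeTo_vertical_column]
            exact_mod_cast (hs (z + 1) (by omega)).2 (by omega)
        rw [hc]
        simp only [this]
        rw [Finset.card_image_of_injective _ fun a b h => by simpa using h, Finset.card_range]
      rw [hcK]
      exact ⟨hK, fun k h1 h2 => (hpos k h1 h2).trans eq_comm⟩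
    rw [← Finset.sum_fiberwise_of_maps_to (t := Finset.Icc 1 m) (g := fun P => c P + 1)
      (fun P hP => Finset.mem_Icc.2 ⟨by omega, (h2 P hP).1⟩), refinedValue]
    refine Finset.sum_congr rfl fun k hk => ?_
    rw [Finset.mem_Icc] at hk
    have h3 : ∀ P ∈ ((edges m).powerset.filter
        (fun P => BoundaryCondition .V3 m P ∧ ∀ p ∈ vertices m, IceRule P p)).filter
        (fun P => c P + 1 = k), t ^ c P = t ^ (k - 1) := by
      intro P hP
      rw [← (Finset.mem_filter.1 hP).2, Nat.add_sub_cancel]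
    rw [Finset.sum_congr rfl h3, Finset.sum_const, nsmul_eq_mul]
    congr 2
    rw [refinedCount]
    congr 1
    ext P
    constructor
    · intro hP
      rw [Finset.mem_filter] at hP
      have hP' : P ∈ (edges m).powerset.filter
          (fun P => BoundaryCondition .V3 m P ∧ ∀ p ∈ vertices m, IceRule P p) :=
        Finset.mem_filter.2 ⟨hP.1, hP.2.1.2.2, hP.2.1.2.1⟩
      exact Finset.mem_filter.2 ⟨hP', ((h2 P hP').2 k hk.1 hk.2).1 hP.2.2⟩
    · intro hP
      rw [Finset.mem_filter] at hP
      have hP' := Finset.mem_filter.1 hP.1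
      exact Finset.mem_filter.2 ⟨hP'.1, ⟨Finset.mem_powerset.1 hP'.1, hP'.2.2, hP'.2.1⟩,
        ((h2 P hP.1).2 k hk.1 hk.2).2 hP.2⟩
  · intro x
    have hd : ∀ e, ¬ ThirdBoundary m e → e ∉ thirdBoundary m := by
      intro e he h
      exact he (Finset.mem_filter.1 h).2
    refine ⟨hd _ (by simp [ThirdBoundary, edgeTo]), hd _ ?_⟩
    simp only [ThirdBoundary, edgeTo, step, Prod.mk_sub_mk]
    omega

/-! ### The states of the third model on the diagonal side. -/

theorem southWestStates_add (P : Finset Edge) (j k : ℕ) : ∀ a b : ℤ,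
    southWestStates P a b (j + k) =
      southWestStates P a b j ++ southWestStates P (a + j) (b - j) k := by
  induction j with
  | zero => intro a b; simp [southWestStates]
  | succ j ih =>
    intro a b
    rw [show j + 1 + k = (j + k) + 1 by ring, southWestStates, ih, southWestStates,
      List.cons_append]
    push_cast
    congr 3 <;> ring

theorem southWestStates_eq_replicate (P : Finset Edge) (u v : Bool) (k : ℕ) : ∀ a b : ℤ,
    (∀ x y, x + y = a + b → a ≤ x → x < a + k →
      (edgeTo .horizontal (x, y) ∈ P ↔ u = true) ∧ (edgeFrom .vertical (x, y) ∈ P ↔ v = true)) →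
    southWestStates P a b k = List.replicate k (u, v) := by
  induction k with
  | zero => intro a b _; rfl
  | succ k ih =>
    intro a b h
    rw [southWestStates, List.replicate_succ, ih (a + 1) (b - 1)]
    · have := h a b rfl le_rfl (by omega)
      simp [this]
    · intro x y h1 h2 h3
      exact h x y (by omega) (by omega) (by push_cast; omega)

theorem mem_thirdBoundary_diag {m : ℕ} {x y : ℤ} (h : (x, y) ∈ vertices m) (h0 : x + y = 0) :
    (edgeTo .horizontal (x, y) ∈ thirdBoundary m ↔ (m : ℤ) - 1 ≤ 2 * y) ∧
    (edgeFrom .vertical (x, y) ∈ thirdBoundary m ↔ 2 * y ≤ (m : ℤ) - 1) := by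
  rw [mem_thirdBoundary (edgeTo_mem_edges _ h), mem_thirdBoundary (edgeFrom_mem_edges _ h)]
  simp only [ThirdBoundary, edgeTo, edgeFrom, step, Prod.mk_sub_mk]
  omega

theorem southWestStates_thirdBoundary_even (k : ℕ) :
    southWestStates (thirdBoundary (2 * k + 2)) (1 - (2 * k + 2 : ℕ)) ((2 * k + 2 : ℕ) - 1)
        (2 * k + 2) =
      List.replicate (k + 1) (true, false) ++ List.replicate (k + 1) (false, true) := by
  have h := southWestStates_add (thirdBoundary (2 * k + 2)) (k + 1) (k + 1)
    (1 - (2 * k + 2 : ℕ)) ((2 * k + 2 : ℕ) - 1)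
  rw [show k + 1 + (k + 1) = 2 * k + 2 by ring] at h
  rw [h]
  push_cast
  congr 1 <;> refine southWestStates_eq_replicate _ _ _ _ _ _ fun x y h1 h2 h3 => ?_ <;>
    push_cast at h3 <;>
    rw [(mem_thirdBoundary_diag (mem_vertices.2 (by push_cast; omega)) (by omega)).1,
      (mem_thirdBoundary_diag (mem_vertices.2 (by push_cast; omega)) (by omega)).2] <;>
    push_cast <;> simp <;> omega

theorem southWestStates_thirdBoundary_odd (k : ℕ) :
    southWestStates (thirdBoundary (2 * k + 1)) (1 - (2 * k + 1 : ℕ)) ((2 * k + 1 : ℕ) - 1)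
        (2 * k + 1) =
      List.replicate k (true, false) ++ (true, true) :: List.replicate k (false, true) := by
  -- The middle vertex, with both external edges on, is isolated between the two halves.
  have h := southWestStates_add (thirdBoundary (2 * k + 1)) k (1 + k)
    (1 - (2 * k + 1 : ℕ)) ((2 * k + 1 : ℕ) - 1)
  rw [southWestStates_add _ 1 k, show k + (1 + k) = 2 * k + 1 by ring] at h
  rw [h]
  push_cast
  rw [← List.singleton_append (l := List.replicate k (false, true))]
  rw [← List.replicate_one (a := (true, true))]
  congr 1
  on_goal 2 => congr 1
  all_goals
    refine southWestStates_eq_replicate _ _ _ _ _ _ fun x y h1 h2 h3 => ?_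
    push_cast at h3
    rw [(mem_thirdBoundary_diag (mem_vertices.2 (by push_cast; omega)) (by omega)).1,
      (mem_thirdBoundary_diag (mem_vertices.2 (by push_cast; omega)) (by omega)).2]
    push_cast
    simp
    omega

theorem refinedValue_third_even (k : ℕ) {t : ℝ} (ht : 1 + t ≠ 0) :
    refinedValue .V3 (2 * k + 2) t = 2 ^ k * (1 + t) * refinedValue .V3 (2 * k + 1) t := by
  rw [refinedValue_third _ (by omega), refinedValue_third _ (by omega),
    southWestStates_thirdBoundary_even, southWestStates_thirdBoundary_odd, diagPartition_even ht]

/-! ### Reflections between the three models. -/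

/-- An involution on sets of edges which matches configurations with given positions matches
their numbers. -/
theorem refinedCount_eq_of_involution {i i' : Model} {m k k' : ℕ} (Φ : Finset Edge → Finset Edge)
    (hsub : ∀ P, P ⊆ edges m → Φ P ⊆ edges m) (hinv : ∀ P, P ⊆ edges m → Φ (Φ P) = P)
    (h : ∀ P, P ⊆ edges m → (IsConfig i m P ∧ HasPosition i m k P ↔
      IsConfig i' m (Φ P) ∧ HasPosition i' m k' (Φ P))) :
    refinedCount i m k = refinedCount i' m k' := by
  classical
  refine Finset.card_nbij' Φ Φ ?_ ?_ ?_ ?_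
  · intro P hP
    simp only [Finset.coe_filter, Finset.mem_powerset, Set.mem_ofPred_eq] at hP ⊢
    exact ⟨hsub P hP.1, (h P hP.1).1 hP.2⟩
  · intro P hP
    simp only [Finset.coe_filter, Finset.mem_powerset, Set.mem_ofPred_eq] at hP ⊢
    refine ⟨hsub P hP.1, (h _ (hsub P hP.1)).2 ?_⟩
    rw [hinv P hP.1]
    exact hP.2
  · intro P hP
    exact hinv P (by simpa using (Finset.mem_filter.1 hP).1)
  · intro P hP
    exact hinv P (by simpa using (Finset.mem_filter.1 hP).1)

/-- The reflection of the triangle which exchanges its North and East sides, on vertices. -/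
def swapNorthEast (m : ℕ) (p : ℤ × ℤ) : ℤ × ℤ := (p.2 - ((m : ℤ) - 1), p.1 + ((m : ℤ) - 1))

/-- The reflection of the triangle which exchanges its North and East sides, on edges. -/
def swapNorthEastEdge (m : ℕ) : Edge → Edge
  | (.horizontal, p) => edgeTo .vertical (swapNorthEast m p)
  | (.diagonal, p) => edgeTo .diagonal (swapNorthEast m p)
  | (.vertical, p) => edgeTo .horizontal (swapNorthEast m p)

theorem swapNorthEast_involutive (m : ℕ) : Function.Involutive (swapNorthEast m) := by
  rintro ⟨x, y⟩
  simp [swapNorthEast]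

theorem swapNorthEastEdge_involutive (m : ℕ) : Function.Involutive (swapNorthEastEdge m) := by
  rintro ⟨d, x, y⟩
  cases d <;> simp [swapNorthEastEdge, swapNorthEast, edgeTo, step] <;> omega

theorem swapNorthEast_mem {m : ℕ} {p : ℤ × ℤ} (hp : p ∈ vertices m) :
    swapNorthEast m p ∈ vertices m := by
  obtain ⟨x, y⟩ := p
  rw [mem_vertices] at hp
  rw [swapNorthEast, mem_vertices]
  dsimp only
  omega

/-- The direction of the image of an edge by the reflection `swapNorthEast`. -/
def Dir.swapHV : Dir → Dir
  | .horizontal => .vertical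
  | .diagonal => .diagonal
  | .vertical => .horizontal

theorem swapNorthEastEdge_edgeFrom (m : ℕ) (d : Dir) (p : ℤ × ℤ) :
    swapNorthEastEdge m (edgeFrom d p) = edgeTo d.swapHV (swapNorthEast m p) := by
  cases d <;> rfl

theorem swapNorthEastEdge_edgeTo (m : ℕ) (d : Dir) (p : ℤ × ℤ) :
    swapNorthEastEdge m (edgeTo d p) = edgeFrom d.swapHV (swapNorthEast m p) := by
  cases d <;>
    simp [swapNorthEastEdge, edgeTo, edgeFrom, swapNorthEast, step, Dir.swapHV] <;> omega

/-- The image of a set of edges by the reflection which exchanges the North and East sides. -/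
def reflectNorthEast (m : ℕ) (P : Finset Edge) : Finset Edge := P.image (swapNorthEastEdge m)

theorem mem_reflectNorthEast {m : ℕ} {P : Finset Edge} {e : Edge} :
    e ∈ reflectNorthEast m P ↔ swapNorthEastEdge m e ∈ P := by
  rw [reflectNorthEast, Finset.mem_image]
  constructor
  · rintro ⟨e', he', rfl⟩
    rwa [swapNorthEastEdge_involutive m]
  · exact fun h => ⟨_, h, swapNorthEastEdge_involutive m e⟩

theorem swapNorthEastEdge_mem {m : ℕ} {e : Edge} (he : e ∈ edges m) :
    swapNorthEastEdge m e ∈ edges m := by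
  obtain ⟨p, hp, d, rfl | rfl⟩ := mem_edges.1 he
  · rw [swapNorthEastEdge_edgeTo]
    exact edgeFrom_mem_edges _ (swapNorthEast_mem hp)
  · rw [swapNorthEastEdge_edgeFrom]
    exact edgeTo_mem_edges _ (swapNorthEast_mem hp)

theorem reflectNorthEast_subset {m : ℕ} {P : Finset Edge} (hP : P ⊆ edges m) :
    reflectNorthEast m P ⊆ edges m := by
  intro e he
  rw [mem_reflectNorthEast] at he
  simpa [swapNorthEastEdge_involutive m e] using swapNorthEastEdge_mem (hP he)

theorem forall_vertices_iff {m : ℕ} {f : ℤ × ℤ → ℤ × ℤ} (hf : Function.Involutive f)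
    (hfm : ∀ p ∈ vertices m, f p ∈ vertices m) {q q' : ℤ × ℤ → Prop}
    (h : ∀ p ∈ vertices m, (q p ↔ q' (f p))) :
    (∀ p ∈ vertices m, q p) ↔ ∀ p ∈ vertices m, q' p :=
  ⟨fun H p hp => by simpa [hf p] using (h _ (hfm p hp)).1 (H _ (hfm p hp)),
    fun H p hp => (h p hp).2 (H _ (hfm p hp))⟩

/-- The reflection exchanging the North and East sides sends path steps to path steps, traversed
backwards. It carries the vertex `(k - m, m - 1)` of the top row to `(0, k - 1)`. -/
theorem refinedCount_first (m k : ℕ) : refinedCount .V1 m k = refinedCount .V2 m k := by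
  refine refinedCount_eq_of_involution (reflectNorthEast m)
    (fun P hP => reflectNorthEast_subset hP) (fun P _ => ?_) fun P hP => ?_
  · ext e
    rw [mem_reflectNorthEast, mem_reflectNorthEast, swapNorthEastEdge_involutive m]
  · have hto : ∀ d p, edgeTo d (swapNorthEast m p) ∈ reflectNorthEast m P ↔
        edgeFrom d.swapHV p ∈ P := by
      intro d p
      rw [mem_reflectNorthEast, swapNorthEastEdge_edgeTo, swapNorthEast_involutive m]
    have hfrom : ∀ d p, edgeFrom d (swapNorthEast m p) ∈ reflectNorthEast m P ↔
        edgeTo d.swapHV p ∈ P := by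
      intro d p
      rw [mem_reflectNorthEast, swapNorthEastEdge_edgeFrom, swapNorthEast_involutive m]
    have hvis : ∀ p, Visited P p ↔ Visited (reflectNorthEast m P) (swapNorthEast m p) := by
      intro p
      simp only [Visited, hto, hfrom]
      constructor
      · rintro ⟨d, hd⟩
        refine ⟨d.swapHV, ?_⟩
        cases d <;> simpa [Dir.swapHV, or_comm] using hd
      · rintro ⟨d, hd⟩
        exact ⟨d.swapHV, hd.symm⟩
    refine and_congr ?_ ?_
    · simp only [IsConfig, hP, reflectNorthEast_subset hP, true_and]
      refine and_congr (forall_vertices_iff (swapNorthEast_involutive m)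
        (fun p => swapNorthEast_mem) fun p hp => ?_) (forall_vertices_iff
        (swapNorthEast_involutive m) (fun p => swapNorthEast_mem) fun p hp => ?_)
      · simp only [iceRule_iff, hto, hfrom, Dir.swapHV]
        omega
      · obtain ⟨x, y⟩ := p
        simp only [hto, hfrom, Dir.swapHV]
        simp only [swapNorthEast, northPath, eastPath, diagPath]
        have e1 : x + ((m : ℤ) - 1) = (m : ℤ) - 1 ↔ x = 0 := by omega
        have e2 : y - ((m : ℤ) - 1) = 0 ↔ y = (m : ℤ) - 1 := by omega
        have e3 : y - ((m : ℤ) - 1) + (x + ((m : ℤ) - 1)) = 0 ↔ x + y = 0 := by omega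
        have e4 : 2 * (y - ((m : ℤ) - 1)) + ((m : ℤ) - 1) ≤ 0 ↔ 2 * y ≤ (m : ℤ) - 1 := by omega
        have e5 : 2 * (y - ((m : ℤ) - 1)) + ((m : ℤ) - 1) < 0 ↔ 2 * y < (m : ℤ) - 1 := by omega
        rw [e1, e2, e3, e4, e5]
        exact ⟨fun h => ⟨fun a => (h.2.1 a).symm, fun a => (h.1 a).symm, fun a => (h.2.2 a).symm⟩,
          fun h => ⟨fun a => (h.2.1 a).symm, fun a => (h.1 a).symm, fun a => (h.2.2 a).symm⟩⟩
    · simp only [HasPosition, hvis]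
      refine and_congr ?_ ⟨fun H y h1 h2 => ?_, fun H x h1 h2 => ?_⟩
      · simp [swapNorthEast]
      · simpa [swapNorthEast] using H (y - ((m : ℤ) - 1)) (by omega) (by omega)
      · simpa [swapNorthEast] using H (x + ((m : ℤ) - 1)) (by omega) (by omega)

/-- The reflection of the triangle which exchanges its North and diagonal sides, on vertices. -/
def swapNorthDiag (m : ℕ) (p : ℤ × ℤ) : ℤ × ℤ := (p.1, (m : ℤ) - 1 - p.1 - p.2)

/-- The reflection of the triangle which exchanges its North and diagonal sides, on edges. -/
def swapNorthDiagEdge (m : ℕ) : Edge → Edge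
  | (.horizontal, p) => edgeFrom .diagonal (swapNorthDiag m p)
  | (.diagonal, p) => edgeFrom .horizontal (swapNorthDiag m p)
  | (.vertical, p) => edgeTo .vertical (swapNorthDiag m p)

theorem swapNorthDiag_involutive (m : ℕ) : Function.Involutive (swapNorthDiag m) := by
  rintro ⟨x, y⟩
  simp [swapNorthDiag]

theorem swapNorthDiagEdge_involutive (m : ℕ) : Function.Involutive (swapNorthDiagEdge m) := by
  rintro ⟨d, x, y⟩
  cases d <;> simp [swapNorthDiagEdge, swapNorthDiag, edgeTo, edgeFrom, step]
  ring

theorem swapNorthDiag_mem {m : ℕ} {p : ℤ × ℤ} (hp : p ∈ vertices m) :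
    swapNorthDiag m p ∈ vertices m := by
  obtain ⟨x, y⟩ := p
  rw [mem_vertices] at hp
  rw [swapNorthDiag, mem_vertices]
  dsimp only
  omega

theorem swapNorthDiagEdge_to_horizontal (m : ℕ) (p : ℤ × ℤ) :
    swapNorthDiagEdge m (edgeTo .horizontal p) = edgeTo .diagonal (swapNorthDiag m p) := by
  simp [swapNorthDiagEdge, edgeTo, edgeFrom, swapNorthDiag, step]
  omega

theorem swapNorthDiagEdge_to_diagonal (m : ℕ) (p : ℤ × ℤ) :
    swapNorthDiagEdge m (edgeTo .diagonal p) = edgeTo .horizontal (swapNorthDiag m p) := by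
  simp [swapNorthDiagEdge, edgeTo, edgeFrom, swapNorthDiag, step]
  omega

theorem swapNorthDiagEdge_to_vertical (m : ℕ) (p : ℤ × ℤ) :
    swapNorthDiagEdge m (edgeTo .vertical p) = edgeFrom .vertical (swapNorthDiag m p) := by
  simp [swapNorthDiagEdge, edgeTo, edgeFrom, swapNorthDiag, step]
  omega

theorem swapNorthDiagEdge_mem {m : ℕ} {e : Edge} (he : e ∈ edges m) :
    swapNorthDiagEdge m e ∈ edges m := by
  obtain ⟨p, hp, d, rfl | rfl⟩ := mem_edges.1 he <;> cases d
  · rw [swapNorthDiagEdge_to_horizontal]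
    exact edgeTo_mem_edges _ (swapNorthDiag_mem hp)
  · rw [swapNorthDiagEdge_to_diagonal]
    exact edgeTo_mem_edges _ (swapNorthDiag_mem hp)
  · rw [swapNorthDiagEdge_to_vertical]
    exact edgeFrom_mem_edges _ (swapNorthDiag_mem hp)
  · exact edgeFrom_mem_edges _ (swapNorthDiag_mem hp)
  · exact edgeFrom_mem_edges _ (swapNorthDiag_mem hp)
  · exact edgeTo_mem_edges _ (swapNorthDiag_mem hp)

/-- The image of an orientation by the reflection which exchanges the North and diagonal sides.
It reverses the vertical line, so that the vertical path steps are complemented. -/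
noncomputable def reflectNorthDiag (m : ℕ) (P : Finset Edge) : Finset Edge :=
  (edges m).filter fun e => e.1 = .vertical ↔ swapNorthDiagEdge m e ∉ P

theorem mem_reflectNorthDiag {m : ℕ} {P : Finset Edge} {e : Edge} (he : e ∈ edges m) :
    e ∈ reflectNorthDiag m P ↔ (e.1 = .vertical ↔ swapNorthDiagEdge m e ∉ P) := by
  simp [reflectNorthDiag, he]

theorem swapNorthDiagEdge_fst (m : ℕ) (e : Edge) :
    (swapNorthDiagEdge m e).1 = .vertical ↔ e.1 = .vertical := by
  obtain ⟨d, p⟩ := e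
  cases d <;> simp [swapNorthDiagEdge, edgeTo, edgeFrom]

theorem reflectNorthDiag_reflectNorthDiag {m : ℕ} {P : Finset Edge} (hP : P ⊆ edges m) :
    reflectNorthDiag m (reflectNorthDiag m P) = P := by
  ext e
  by_cases he : e ∈ edges m
  · rw [mem_reflectNorthDiag he, mem_reflectNorthDiag (swapNorthDiagEdge_mem he),
      swapNorthDiagEdge_fst, swapNorthDiagEdge_involutive m]
    tauto
  · exact iff_of_false (fun h => he (Finset.mem_filter.1 h).1) fun h => he (hP h)

theorem edge_mem_reflectNorthDiag {m : ℕ} {P : Finset Edge} {p : ℤ × ℤ} (hp : p ∈ vertices m) :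
    (edgeTo .horizontal (swapNorthDiag m p) ∈ reflectNorthDiag m P ↔ edgeTo .diagonal p ∈ P) ∧
    (edgeTo .diagonal (swapNorthDiag m p) ∈ reflectNorthDiag m P ↔ edgeTo .horizontal p ∈ P) ∧
    (edgeTo .vertical (swapNorthDiag m p) ∈ reflectNorthDiag m P ↔ edgeFrom .vertical p ∉ P) ∧
    (edgeFrom .horizontal (swapNorthDiag m p) ∈ reflectNorthDiag m P ↔ edgeFrom .diagonal p ∈ P) ∧
    (edgeFrom .diagonal (swapNorthDiag m p) ∈ reflectNorthDiag m P ↔ edgeFrom .horizontal p ∈ P) ∧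
    (edgeFrom .vertical (swapNorthDiag m p) ∈ reflectNorthDiag m P ↔ edgeTo .vertical p ∉ P) := by
  have hq := swapNorthDiag_mem hp
  refine ⟨?_, ?_, ?_, ?_, ?_, ?_⟩
  · rw [mem_reflectNorthDiag (edgeTo_mem_edges _ hq), swapNorthDiagEdge_to_horizontal,
      swapNorthDiag_involutive m]
    simp [edgeTo]
  · rw [mem_reflectNorthDiag (edgeTo_mem_edges _ hq), swapNorthDiagEdge_to_diagonal,
      swapNorthDiag_involutive m]
    simp [edgeTo]
  · rw [mem_reflectNorthDiag (edgeTo_mem_edges _ hq), swapNorthDiagEdge_to_vertical,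
      swapNorthDiag_involutive m]
    simp [edgeTo]
  · rw [mem_reflectNorthDiag (edgeFrom_mem_edges _ hq)]
    simp [edgeFrom, swapNorthDiagEdge, swapNorthDiag_involutive m p]
  · rw [mem_reflectNorthDiag (edgeFrom_mem_edges _ hq)]
    simp [edgeFrom, swapNorthDiagEdge, swapNorthDiag_involutive m p]
  · rw [mem_reflectNorthDiag (edgeFrom_mem_edges _ hq)]
    simp [edgeFrom, swapNorthDiagEdge, swapNorthDiag_involutive m p]

/-- The reflection swaps W with NW, E with SE and N with S. Complementing the vertical edges as well
moves the North and South terms to opposite sides of the conservation law, which is preserved. On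
the boundary, the full South edges of 20V2 become the empty North edges of 20V3. -/
theorem isConfig_reflectNorthDiag {m : ℕ} {P : Finset Edge} (hP : P ⊆ edges m) :
    IsConfig .V2 m P ↔ IsConfig .V3 m (reflectNorthDiag m P) := by
  have hP' : reflectNorthDiag m P ⊆ edges m := fun e he => (Finset.mem_filter.1 he).1
  simp only [IsConfig, hP, hP', true_and]
  refine and_congr (forall_vertices_iff (swapNorthDiag_involutive m)
    (fun p => swapNorthDiag_mem) fun p hp => ?_) (forall_vertices_iff
    (swapNorthDiag_involutive m) (fun p => swapNorthDiag_mem) fun p hp => ?_)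
  · have h : ∀ b : Bool, (!b).toNat = 1 - b.toNat := by decide
    simp only [iceRule_iff, edge_mem_reflectNorthDiag hp, decide_not, h]
    have := Bool.toNat_le (decide (edgeTo .vertical p ∈ P))
    have := Bool.toNat_le (decide (edgeFrom .vertical p ∈ P))
    omega
  · simp only [edge_mem_reflectNorthDiag hp]
    obtain ⟨x, y⟩ := p
    simp only [swapNorthDiag, northPath, eastPath, diagPath]
    have e1 : (m : ℤ) - 1 - x - y = (m : ℤ) - 1 ↔ x + y = 0 := by omega
    have e2 : x + ((m : ℤ) - 1 - x - y) = 0 ↔ y = (m : ℤ) - 1 := by omega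
    have e3 : y = (m : ℤ) - 1 → ((m : ℤ) - 1 ≤ 2 * ((m : ℤ) - 1 - x - y) ↔
      2 * x + ((m : ℤ) - 1) ≤ 0) := by omega
    have e4 : y = (m : ℤ) - 1 → (2 * ((m : ℤ) - 1 - x - y) ≤ (m : ℤ) - 1 ↔
      ¬ 2 * x + ((m : ℤ) - 1) < 0) := by omega
    rw [e1, e2]
    constructor
    · rintro ⟨h1, h2, h3⟩
      refine ⟨fun a => ⟨(h3 a).1, by simp [(h3 a).2]⟩, fun a => (h2 a).symm, fun a => ⟨?_, ?_⟩⟩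
      · rw [e3 a]
        exact (h1 a).1
      · rw [e4 a, not_iff_not]
        exact (h1 a).2
    · rintro ⟨h1, h2, h3⟩
      refine ⟨fun a => ⟨?_, ?_⟩, fun a => (h2 a).symm, fun a => ⟨(h1 a).1, by simpa using (h1 a).2⟩⟩
      · rw [← e3 a]
        exact (h3 a).1
      · rw [← not_iff_not, ← e4 a]
        exact (h3 a).2

theorem refinedCount_second {m k : ℕ} (hk : 1 ≤ k) (hkm : k ≤ m) :
    refinedCount .V2 m k = refinedCount .V3 m (m + 1 - k) := by
  refine refinedCount_eq_of_involution (reflectNorthDiag m)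
    (fun P _ e he => (Finset.mem_filter.1 he).1)
    (fun P hP => reflectNorthDiag_reflectNorthDiag hP) fun P hP => ?_
  rw [← isConfig_reflectNorthDiag hP]
  refine and_congr_right fun hc => ?_
  obtain ⟨K, hK, hs, hpos⟩ := hc.exists_column (by simp) (by omega)
  obtain ⟨K', hK', hs', hpos'⟩ :=
    ((isConfig_reflectNorthDiag hP).1 hc).exists_column (by simp) (by omega)
  rw [hpos k hk hkm, hpos' _ (by omega) (by omega)]
  -- The South edge at height `y` of the image is the complement of the North edge at height `m - 1
  -- - y`, that is, of the South edge at height `m - y`. Evaluating at `K'` and at `m - 1 - K`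
  -- forces `K' = m - 1 - K`.
  have key : ∀ y : ℕ, y < m → (y ≤ K' ↔ ¬ m - y ≤ K) := by
    intro y hy
    rw [← hs' y hy.le, ← hs (m - y) (by omega)]
    have hp : ((0 : ℤ), (m : ℤ) - 1 - y) ∈ vertices m := mem_vertices.2 (by omega)
    have h := (edge_mem_reflectNorthDiag (P := P) hp).2.2.2.2.2
    rw [edgeTo_vertical_column] at h
    convert h using 3
    · simp [swapNorthDiag]
    · push_cast [hy.le]; ring_nf
  have h1 := key K' hK'
  have h2 := key (m - 1 - K) (by omega)
  omega

/-! ### Transfer to all models and to polynomials. -/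

theorem refinedValue_second (m : ℕ) {t : ℝ} (ht : t ≠ 0) :
    refinedValue .V2 m t = t ^ (m - 1) * refinedValue .V3 m t⁻¹ := by
  rw [refinedValue, refinedValue, Finset.mul_sum]
  refine Finset.sum_nbij' (fun k => m + 1 - k) (fun k => m + 1 - k) ?_ ?_ ?_ ?_ ?_
  all_goals
    intro k hk
    rw [Finset.mem_Icc] at hk
  · exact Finset.mem_Icc.2 (by omega)
  · exact Finset.mem_Icc.2 (by omega)
  · omega
  · omega
  · rw [refinedCount_second hk.1 hk.2, mul_left_comm]
    congr 1
    rw [inv_pow, ← div_eq_mul_inv, eq_div_iff (pow_ne_zero _ ht), ← pow_add]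
    congr 1
    omega

theorem refinedValue_even (i : Model) (k : ℕ) {t : ℝ} (ht : 0 < t) :
    refinedValue i (2 * k + 2) t = 2 ^ k * (1 + t) * refinedValue i (2 * k + 1) t := by
  have h2 : refinedValue .V2 (2 * k + 2) t =
      2 ^ k * (1 + t) * refinedValue .V2 (2 * k + 1) t := by
    rw [refinedValue_second _ ht.ne', refinedValue_second _ ht.ne',
      refinedValue_third_even k (by positivity)]
    -- The extra power of `t` in even size absorbs the inversion: `t * (1 + t⁻¹) = 1 + t`.
    simp only [Nat.add_sub_cancel, show 2 * k + 2 - 1 = 2 * k + 1 by omega, pow_succ t]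
    field_simp
    ring
  cases i with
  | V1 =>
    have h : ∀ m, refinedValue .V1 m t = refinedValue .V2 m t := by
      intro m
      simp only [refinedValue, refinedCount_first]
    rw [h, h, h2]
  | V2 => exact h2
  | V3 => exact refinedValue_third_even k (by positivity)

theorem eval_map_refinedZ (i : Model) (m : ℕ) (t : ℝ) :
    ((refinedZ i m).map (Int.castRingHom ℝ)).eval t = refinedValue i m t := by
  simp [refinedZ, refinedValue, Polynomial.map_sum, Polynomial.eval_finsetSum]

end TwentyV

theorem mainTheorem8 (i : TwentyV.Model) (n : ℕ) (hn : 1 ≤ n) :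
    TwentyV.refinedZ i (2 * n) =
      2 ^ (n - 1) * (1 + Polynomial.X) * TwentyV.refinedZ i (2 * n - 1) := by
  obtain ⟨k, rfl⟩ := Nat.exists_eq_add_of_le' hn
  rw [show 2 * (k + 1) = 2 * k + 2 by ring, show 2 * k + 2 - 1 = 2 * k + 1 by omega,
    Nat.add_sub_cancel]
  -- Real values are needed for √2, and positive ones keep `t` and `1 + t` nonzero; infinitely many
  -- suffice.
  apply Polynomial.map_injective (Int.castRingHom ℝ) Int.cast_injective
  refine Polynomial.eq_of_infinite_eval_eq _ _ ((Set.Ioi_infinite (0 : ℝ)).mono fun t ht => ?_)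
  have h := TwentyV.refinedValue_even i k (Set.mem_Ioi.1 ht)
  rw [← TwentyV.eval_map_refinedZ, ← TwentyV.eval_map_refinedZ] at h
  rw [Set.mem_ofPred_eq, h]
  simp
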